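/- Let $d\ge 3$ be an integer, $\beta>0$ and $K\ge 1$ real numbers. For an open set $S\subset\mathbb R^d$ and $f\in\mathcal C^{\lfloor\beta\rfloor}(S)$ let $$\|f\|_{\mathcal H^\beta(S)}=\sum_{0\le|\nu|\le\lfloor\beta\rfloor}\sup_{S}|\partial^\nu f|+\sum_{|\nu|=\lfloor\beta\rfloor}\ \sup_{x\ne y\in S}\frac{|\partial^\nu f(x)-\partial^\nu f(y)|}{\|x-y\|^{\beta-\lfloor\beta\rfloor}} .$$ Let $\mathcal A^\beta_K$ be the set of all probability densities $p:\mathbb R^d\to[0,\infty)$ that can be written as $p(x)=\exp(-u(x)+a(x))$ with $u:\mathbb R^d\to\mathbb R\cup\{\infty\}$, $a:\mathbb R^d\to\mathbb R$ (and $e^{-\infty}=0$), such that, with $S=\{p>0\}=\{u<\infty\}$, 1. $a\in\mathcal C^{\lfloor\beta\rfloor}(S)$ with $\|a\|_{\mathcal H^\beta(S)}\le K$, and $u\in\mathcal C^{1+\max\{1,\lfloor\beta\rfloor\}}(S)$; 2. $S$ is convex and $\nabla^2u(x)\succeq K^{-1}I_d$ for all $x\in S$; 3. $u$ has a unique minimizer,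 and its norm is at most $K$; 4. for all $x\in S$ and $y\in\mathbb R^d$ with $\|x-y\|\le (K\max\{1,|u(x)|\})^{-K}$ one has $y\in S$ and $\|\nabla^ku(y)\|\le K(1+|u(x)|^K)$ (operator norm) for all $k\in\{0,\dots,\lfloor\beta\rfloor+1\}$. (In particular $S$ is open.) For probability distributions $P,Q$ on $\mathbb R^d$ let $\mathrm W_1(P,Q)\in[0,\infty]$ be the supremum of $\int f\,dP-\int f\,dQ$ over all $1$-Lipschitz functions $f:\mathbb R^d\to\mathbb R$ that are integrable with respect to both $P$ and $Q$; a density is identified with the distribution it defines. **Theorem (Main minimax lower bound).** There is a constant $c>0$ depending only on $d$, $\beta$ and $K$ such that for every integer $n\ge1$ $$\inf_{\widehat p_n}\ \sup_{p^\star\in\mathcal A^\beta_K}\ \mathbb E_{X^{(1)},\dots,X^{(n)}\overset{\text{i.i.d.}}{\sim}p^\star}\bigl[\mathrm W_1(p^\star,\widehat p_n)\bigr]\ \ge\ c\,n^{-\frac{\beta+1}{2\beta+d}},$$ where the infimum is over all estimators, i.e. all measurable maps $\widehat p_n$ that assign to the sample $(X^{(1)},\dots,X^{(n)})$ a probability distribution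 on $\mathbb R^d$. -/

import Mathlib

open MeasureTheory ProbabilityTheory
open scoped ENNReal

/-- The first-order partial derivative of `f : ℝᵈ → ℝ` in the `i`-th coordinate. -/
noncomputable def coordDeriv {d : ℕ} (i : Fin d) (f : EuclideanSpace ℝ (Fin d) → ℝ) :
    EuclideanSpace ℝ (Fin d) → ℝ :=
  fun x => fderiv ℝ f x (EuclideanSpace.single i 1)

/-- The partial derivative `∂^ν f = ∂^{|ν|} f / ∂x₁^{ν₁} ⋯ ∂x_d^{ν_d}` of multi-index `ν`. -/
noncomputable def multiDeriv {d : ℕ} (ν : Fin d → ℕ) (f : EuclideanSpace ℝ (Fin d) → ℝ) :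
    EuclideanSpace ℝ (Fin d) → ℝ :=
  (List.finRange d).foldr (fun i g => (coordDeriv i)^[ν i] g) f

/-- The supremum norm of `f` on the set `s`, with values in `[0, ∞]`. -/
noncomputable def supENormOn {d : ℕ} (f : EuclideanSpace ℝ (Fin d) → ℝ)
    (s : Set (EuclideanSpace ℝ (Fin d))) : ℝ≥0∞ :=
  ⨆ x ∈ s, ENNReal.ofReal |f x|

/-- The seminorm `sup_{x ≠ y} |f x - f y| / ‖x - y‖ ^ α` over `x, y ∈ s`,
with values in `[0, ∞]`. -/
noncomputable def holderESeminormOn {d : ℕ} (α : ℝ) (f : EuclideanSpace ℝ (Fin d) → ℝ)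
    (s : Set (EuclideanSpace ℝ (Fin d))) : ℝ≥0∞ :=
  ⨆ x ∈ s, ⨆ y ∈ s, ⨆ _ : x ≠ y, ENNReal.ofReal (|f x - f y| / ‖x - y‖ ^ α)

/-- The Hölder norm of regularity `η` on `s`. The finset `Finset.piAntidiag Finset.univ k` is the
set of all multi-indices `ν` with `|ν| = k`. -/
noncomputable def holderENormOn {d : ℕ} (η : ℝ) (f : EuclideanSpace ℝ (Fin d) → ℝ)
    (s : Set (EuclideanSpace ℝ (Fin d))) : ℝ≥0∞ :=
  (∑ k ∈ Finset.range (⌊η⌋₊ + 1),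
      ∑ ν ∈ Finset.piAntidiag (Finset.univ : Finset (Fin d)) k, supENormOn (multiDeriv ν f) s)
    + ∑ ν ∈ Finset.piAntidiag (Finset.univ : Finset (Fin d)) ⌊η⌋₊,
        holderESeminormOn (η - (⌊η⌋₊ : ℝ)) (multiDeriv ν f) s

/-- The Hölder ball of regularity `η` and radius `K` on the set `s`. -/
def holderBallOn (d : ℕ) (η K : ℝ) (s : Set (EuclideanSpace ℝ (Fin d))) :
    Set (EuclideanSpace ℝ (Fin d) → ℝ) :=
  {f | ContDiffOn ℝ (⌊η⌋₊ : ℕ) f s ∧ holderENormOn η f s ≤ ENNReal.ofReal K}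

/-- `p` is a probability density with respect to Lebesgue measure on `ℝᵈ`. -/
structure IsProbDensity {d : ℕ} (p : EuclideanSpace ℝ (Fin d) → ℝ) : Prop where
  measurable : Measurable p
  nonneg : ∀ x, 0 ≤ p x
  lintegral_eq_one : ∫⁻ x, ENNReal.ofReal (p x) = 1

/-- The finite values of a potential `u : ℝᵈ → ℝ ∪ {∞}` (and `0` where `u = ∞`; this value is never
used). -/
noncomputable def finitePart {d : ℕ} (u : EuclideanSpace ℝ (Fin d) → WithTop ℝ) :
    EuclideanSpace ℝ (Fin d) → ℝ :=
  fun x => (u x).untopD 0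

/-- The density `p` is written as `exp (-u + a)` with a potential `u : ℝᵈ → ℝ ∪ {∞}` and a
perturbation `a`, which satisfy the regularity requirements of the model with smoothness `β` and
constant `K`. Here `Function.support p = {x | p x ≠ 0} = {x | u x < ∞}`. -/
structure IsModelDecomposition {d : ℕ} (β K : ℝ) (p : EuclideanSpace ℝ (Fin d) → ℝ)
    (u : EuclideanSpace ℝ (Fin d) → WithTop ℝ) (a : EuclideanSpace ℝ (Fin d) → ℝ) : Prop where
  /-- `p = exp (-u + a)`, where `exp (-∞) = 0`. -/
  eq_exp : ∀ x, p x = if u x = ⊤ then 0 else Real.exp (-finitePart u x + a x)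
  /-- The perturbation is in the Hölder ball on the support of `p`. -/
  holder : a ∈ holderBallOn d β K (Function.support p)
  /-- The potential has regularity `1 + max {1, ⌊β⌋}` on the support of `p`. -/
  contDiffOn : ContDiffOn ℝ ((1 + max 1 ⌊β⌋₊ : ℕ)) (finitePart u) (Function.support p)
  /-- `u` is a convex function with values in `ℝ ∪ {∞}`: its domain is convex ... -/
  convex_support : Convex ℝ (Function.support p)
  /-- ... and its Hessian is at least `K⁻¹ I` on its domain. -/
  hessian_ge : ∀ x ∈ Function.support p, ∀ v : EuclideanSpace ℝ (Fin d),
    K⁻¹ * ‖v‖ ^ 2 ≤ iteratedFDeriv ℝ 2 (finitePart u) x ![v, v]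
  /-- The minimizer of `u` has norm at most `K`. -/
  argmin_le : ∃ x₀, {x | ∀ y, u x ≤ u y} = {x₀} ∧ ‖x₀‖ ≤ K
  /-- Control of the growth of `u`. For `u x = ∞` the condition is void; for `u x < ∞` the bound of
  order `k = 0` contains that `u y < ∞`. -/
  growth : ∀ x y, u x ≠ ⊤ → ‖x - y‖ ≤ (K * max 1 |finitePart u x|) ^ (-K) →
    u y ≠ ⊤ ∧ ∀ k ≤ ⌊β⌋₊ + 1,
      ‖iteratedFDeriv ℝ k (finitePart u) y‖ ≤ K * (1 + |finitePart u x| ^ K)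

/-- The statistical model `𝒜^β_K` of probability densities on `ℝᵈ`. -/
def densityModel (d : ℕ) (β K : ℝ) : Set (EuclideanSpace ℝ (Fin d) → ℝ) :=
  {p | IsProbDensity p ∧ ∃ u a, IsModelDecomposition β K p u a}

/-- The distribution `p(x) dx` on `ℝᵈ`. -/
noncomputable def densityLaw {d : ℕ} (p : EuclideanSpace ℝ (Fin d) → ℝ) :
    Measure (EuclideanSpace ℝ (Fin d)) :=
  volume.withDensity fun x => ENNReal.ofReal (p x)

/-- The `1`-Wasserstein distance in dual form, with values in `[0, ∞]`: the supremum of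
`∫ f dP - ∫ f dQ` over the `1`-Lipschitz functions `f` for which both integrals exist. For `P` and
`Q` with finite first moments these are all `1`-Lipschitz functions; if exactly one of them has a
finite first moment, the value is `∞`. -/
noncomputable def wassersteinOne {d : ℕ} (P Q : Measure (EuclideanSpace ℝ (Fin d))) : ℝ≥0∞ :=
  ⨆ (f : EuclideanSpace ℝ (Fin d) → ℝ) (_ : LipschitzWith 1 f) (_ : Integrable f P)
    (_ : Integrable f Q), ENNReal.ofReal ((∫ x, f x ∂P) - ∫ x, f x ∂Q)

/-- The minimax risk over `𝒜^β_K` for `n` i.i.d. observations. An estimator is a measurable map that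
sends a sample `(X₁, …, Xₙ)` to a probability distribution on `ℝᵈ`, which is a Markov kernel. -/
noncomputable def wassersteinMinimaxRisk (d n : ℕ) (β K : ℝ) : ℝ≥0∞ :=
  ⨅ (T : Kernel (Fin n → EuclideanSpace ℝ (Fin d)) (EuclideanSpace ℝ (Fin d)))
    (_ : IsMarkovKernel T),
    ⨆ p ∈ densityModel d β K,
      ∫⁻ X, wassersteinOne (densityLaw p) (T X) ∂(Measure.pi fun _ : Fin n => densityLaw p)

/-!
The lower bound is Assouad's method over a cube of perturbed Gaussian densities.

The potential is fixed: `u x = ‖x‖² / 2 + c`. The perturbations are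
`a_s x = κ ∑ₖ sₖ (ψ (x / h - zₖ) - ψ (x / h + zₖ))` with signs `sₖ = ±1`, a radial bump `ψ`, the
points `zₖ` of `{1, …, m}ᵈ`, bandwidth `h = 1 / m` and amplitude `κ = ε h ^ β`. The scaling
`κ = ε h ^ β` keeps them in the unit Hölder ball (`exists_holderENormOn_bumpSum_le`). A fixed
potential needs a normalising constant that does not depend on the signs. This is why each bump
comes with its negative at the mirrored centre: `a_s` is odd, the Gaussian weight is even, so that
`exp a_s` may be replaced by `cosh a_s` in the total mass, and `cosh a_s` does not depend on the
signs as the bumps have disjoint supports (`integral_gaussianWeight_mul_exp_perturbation`). The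
constant is at least `e²` in dimension `d ≥ 3`, and with this `u` satisfies the growth condition for
every `K ≥ 1` (`mem_densityModel_of_gaussian`).

Two neighbouring densities have affinity `1 - O(κ² h ^ d) = 1 - O(ε² / n)` when `n ≤ m ^ (2 β + d)`
(`affinity_ge`), hence they cannot be told apart from `n` observations (`two_point_bound`). On the
other hand, the test functions `x ↦ (h / L) ψ (x / h - zₖ)`, where `L` bounds the gradient of `ψ`,
have `1`-Lipschitz signed sums; therefore `W₁` is at least the sum over the cells of the errors in
their means (`sum_abs_sub_le_wassersteinOne`), an additive loss. Flipping the sign of a cell changes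
the mean of its test function by order `h κ h ^ d` (`cellMean_sub_ge`). Summing over the
`m ^ d = h ^ (-d)` cells by Assouad's lemma (`assouad`) gives a risk of order `h κ`, that is,
`h ^ (β + 1)`, and `m` of order `n ^ (1 / (2 β + d))` is the smallest admissible choice.
-/

/-! ### Product densities, two-point testing and Assouad's lemma -/

theorem lintegral_pi_ofReal_prod {ι α : Type*} [Fintype ι] [MeasurableSpace α]
    {μ : ι → Measure α} [∀ i, SigmaFinite (μ i)] {p : α → ℝ} (hp : ∀ i, Integrable p (μ i))
    (hp0 : ∀ x, 0 ≤ p x) :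
    ∫⁻ x, ENNReal.ofReal (∏ i, p (x i)) ∂(Measure.pi μ)
      = ∏ i, ∫⁻ y, ENNReal.ofReal (p y) ∂(μ i) := by
  have hint : Integrable (fun x : ι → α => ∏ i, p (x i)) (Measure.pi μ) :=
    Integrable.fintype_prod (f := fun _ => p) hp
  rw [← ofReal_integral_eq_lintegral_ofReal hint
    (ae_of_all _ fun x => Finset.prod_nonneg fun i _ => hp0 _),
    integral_fintype_prod_eq_prod (fun _ => p),
    ENNReal.ofReal_prod_of_nonneg fun i _ => integral_nonneg hp0]
  exact Finset.prod_congr rfl fun i _ =>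
    ofReal_integral_eq_lintegral_ofReal (hp i) (ae_of_all _ hp0)

theorem pi_withDensity_ofReal {ι α : Type*} [Fintype ι] [MeasurableSpace α]
    {μ : Measure α} [SigmaFinite μ] {p : α → ℝ} (hp : Integrable p μ) (hp0 : ∀ x, 0 ≤ p x) :
    Measure.pi (fun _ : ι => μ.withDensity fun x => ENNReal.ofReal (p x))
      = (Measure.pi fun _ : ι => μ).withDensity fun x => ENNReal.ofReal (∏ i, p (x i)) := by
  have : IsFiniteMeasure (μ.withDensity fun x => ENNReal.ofReal (p x)) :=
    isFiniteMeasure_withDensity_ofReal hp.2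
  refine (Measure.pi_eq (μ := fun _ : ι => μ.withDensity fun x => ENNReal.ofReal (p x))
    fun s hs => ?_)
  rw [withDensity_apply _ (MeasurableSet.univ_pi hs), Measure.restrict_pi_pi,
    lintegral_pi_ofReal_prod (μ := fun i => μ.restrict (s i)) (fun _ => hp.restrict) hp0]
  exact Finset.prod_congr rfl fun i _ => (withDensity_apply _ (hs i)).symm

theorem sqrt_mul_le_min_add {a b : ℝ} (ha : 0 ≤ a) (hb : 0 ≤ b) :
    √(a * b) ≤ min a b + (a + b) / 4 := by
  rw [Real.sqrt_le_left (by positivity)]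
  rcases le_total a b with h | h
  · rw [min_eq_left h]
    nlinarith [sq_nonneg (a - b / 4)]
  · rw [min_eq_right h]
    nlinarith [sq_nonneg (b - a / 4)]

/-- Le Cam's two-point bound: if the `n`-fold affinity of two densities is at least `3 / 4`, then
two losses that cannot both be small have a total risk of the same order. The affinity enters
through `√(a b) ≤ min a b + (a + b) / 4`, applied to the product densities. -/
theorem two_point_bound {α : Type*} [MeasurableSpace α] {μ : Measure α} [SigmaFinite μ] {n : ℕ}
    {p q : α → ℝ} (hp : Integrable p μ) (hq : Integrable q μ) (hpm : Measurable p)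
    (hqm : Measurable q) (hp0 : ∀ x, 0 ≤ p x) (hq0 : ∀ x, 0 ≤ q x)
    (hp1 : ∫⁻ x, ENNReal.ofReal (p x) ∂μ = 1) (hq1 : ∫⁻ x, ENNReal.ofReal (q x) ∂μ = 1)
    (hρi : Integrable (fun x => √(p x * q x)) μ) (hρ : 3 / 4 ≤ (∫ x, √(p x * q x) ∂μ) ^ n)
    {F G : (Fin n → α) → ℝ≥0∞} (hF : Measurable F) (hG : Measurable G) {δ : ℝ≥0∞}
    (h : ∀ X, δ ≤ F X + G X) :
    δ * ENNReal.ofReal (1 / 4)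
      ≤ ∫⁻ X, F X ∂(Measure.pi fun _ => μ.withDensity fun x => ENNReal.ofReal (p x))
        + ∫⁻ X, G X ∂(Measure.pi fun _ => μ.withDensity fun x => ENNReal.ofReal (q x)) := by
  set ν : Measure (Fin n → α) := Measure.pi fun _ => μ
  have hPm : Measurable fun X : Fin n → α => ∏ i, p (X i) := by fun_prop
  have hQm : Measurable fun X : Fin n → α => ∏ i, q (X i) := by fun_prop
  have hP0 : ∀ X : Fin n → α, 0 ≤ ∏ i, p (X i) := fun X => Finset.prod_nonneg fun i _ => hp0 _
  have hQ0 : ∀ X : Fin n → α, 0 ≤ ∏ i, q (X i) := fun X => Finset.prod_nonneg fun i _ => hq0 _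
  rw [pi_withDensity_ofReal hp hp0, pi_withDensity_ofReal hq hq0,
    lintegral_withDensity_eq_lintegral_mul _ (by fun_prop) hF,
    lintegral_withDensity_eq_lintegral_mul _ (by fun_prop) hG,
    ← lintegral_add_left (by fun_prop)]
  have hmin : ENNReal.ofReal (1 / 4)
      ≤ ∫⁻ X, ENNReal.ofReal (min (∏ i, p (X i)) (∏ i, q (X i))) ∂ν := by
    have h1 : ENNReal.ofReal (3 / 4) ≤ ∫⁻ X, ENNReal.ofReal (∏ i, √(p (X i) * q (X i))) ∂ν := by
      rw [lintegral_pi_ofReal_prod (p := fun x => √(p x * q x)) (fun _ => hρi)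
        (fun x => Real.sqrt_nonneg _), Finset.prod_const, Finset.card_univ, Fintype.card_fin,
        ← ofReal_integral_eq_lintegral_ofReal hρi (ae_of_all _ fun x => Real.sqrt_nonneg _),
        ← ENNReal.ofReal_pow (integral_nonneg fun x => Real.sqrt_nonneg _)]
      exact ENNReal.ofReal_le_ofReal hρ
    have h2 : ∫⁻ X, ENNReal.ofReal (∏ i, √(p (X i) * q (X i))) ∂ν
        ≤ ∫⁻ X, ENNReal.ofReal (min (∏ i, p (X i)) (∏ i, q (X i))) ∂ν
          + ENNReal.ofReal (1 / 2) := by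
      have hP1 : ∫⁻ X, ENNReal.ofReal (∏ i, p (X i)) ∂ν = 1 := by
        simp [ν, lintegral_pi_ofReal_prod (fun _ => hp) hp0, hp1]
      have hQ1 : ∫⁻ X, ENNReal.ofReal (∏ i, q (X i)) ∂ν = 1 := by
        simp [ν, lintegral_pi_ofReal_prod (fun _ => hq) hq0, hq1]
      calc _ ≤ ∫⁻ X, (ENNReal.ofReal (min (∏ i, p (X i)) (∏ i, q (X i)))
            + ENNReal.ofReal (1 / 4)
              * (ENNReal.ofReal (∏ i, p (X i)) + ENNReal.ofReal (∏ i, q (X i)))) ∂ν := by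
            refine lintegral_mono fun X => ?_
            rw [← ENNReal.ofReal_add (hP0 X) (hQ0 X), ← ENNReal.ofReal_mul (by norm_num),
              ← ENNReal.ofReal_add (le_min (hP0 X) (hQ0 X))
                (mul_nonneg (by norm_num) (add_nonneg (hP0 X) (hQ0 X)))]
            refine ENNReal.ofReal_le_ofReal ?_
            have := sqrt_mul_le_min_add (hP0 X) (hQ0 X)
            rw [← Finset.prod_mul_distrib, Real.sqrt_prod _
              fun i _ => mul_nonneg (hp0 _) (hq0 _)] at this
            linarith
        _ = _ := by
            rw [lintegral_add_left (by fun_prop), lintegral_const_mul _ (by fun_prop),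
              lintegral_add_left (by fun_prop), hP1, hQ1,
              show (1 : ℝ≥0∞) + 1 = ENNReal.ofReal 2 by norm_num,
              ← ENNReal.ofReal_mul (by norm_num)]
            norm_num
    have h3 := h1.trans h2
    rw [show (3 / 4 : ℝ) = 1 / 4 + 1 / 2 by norm_num,
      ENNReal.ofReal_add (by norm_num) (by norm_num)] at h3
    exact (ENNReal.add_le_add_iff_right ENNReal.ofReal_ne_top).1 h3
  calc δ * ENNReal.ofReal (1 / 4)
      ≤ δ * ∫⁻ X, ENNReal.ofReal (min (∏ i, p (X i)) (∏ i, q (X i))) ∂ν := by gcongr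
    _ = ∫⁻ X, δ * ENNReal.ofReal (min (∏ i, p (X i)) (∏ i, q (X i))) ∂ν :=
        (lintegral_const_mul _ (by fun_prop)).symm
    _ ≤ _ := by
        refine lintegral_mono fun X => ?_
        calc _ ≤ (F X + G X) * ENNReal.ofReal (min (∏ i, p (X i)) (∏ i, q (X i))) := by
              gcongr; exact h X
          _ ≤ _ := by
              rw [add_mul, mul_comm (F X), mul_comm (G X)]
              simp only [Pi.mul_apply]
              gcongr
              · exact min_le_left _ _
              · exact min_le_right _ _

/-- Assouad's lemma for additive losses over the hypercube `ι → Bool`: a lower bound `δ` on the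
total loss of any two neighbours in direction `k` forces a risk of order `card ι * δ`. -/
theorem assouad {ι Ω : Type*} [Fintype ι] [DecidableEq ι] [MeasurableSpace Ω]
    (P : (ι → Bool) → Measure Ω) (L : ι → Bool → Ω → ℝ≥0∞) (hL : ∀ k b, Measurable (L k b))
    {δ R : ℝ≥0∞}
    (hδ : ∀ v k, δ ≤ ∫⁻ X, L k (v k) X ∂(P v)
      + ∫⁻ X, L k (!v k) X ∂(P (Function.update v k (!v k))))
    (hR : ∀ v, ∫⁻ X, ∑ k, L k (v k) X ∂(P v) ≤ R) :
    Fintype.card ι * δ ≤ 2 * R := by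
  have hinv : ∀ k : ι, Function.Involutive fun v : ι → Bool => Function.update v k (!v k) := by
    intro k v
    simp
  have h1 : ∀ k : ι, (Fintype.card (ι → Bool)) * δ
      ≤ 2 * ∑ v : ι → Bool, ∫⁻ X, L k (v k) X ∂(P v) := by
    intro k
    have hflip : ∑ v : ι → Bool, ∫⁻ X, L k (!v k) X ∂(P (Function.update v k (!v k)))
        = ∑ v : ι → Bool, ∫⁻ X, L k (v k) X ∂(P v) := by
      refine Fintype.sum_equiv (hinv k).toPerm _ _ fun v => ?_
      simp [Function.Involutive.toPerm]
    calc (Fintype.card (ι → Bool)) * δ = ∑ _v : ι → Bool, δ := by simp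
      _ ≤ _ := Finset.sum_le_sum fun v _ => hδ v k
      _ = _ := by rw [Finset.sum_add_distrib, hflip, two_mul]
  have h2 : (Fintype.card (ι → Bool) : ℝ≥0∞) * (Fintype.card ι * δ)
      ≤ (Fintype.card (ι → Bool) : ℝ≥0∞) * (2 * R) := by
    calc (Fintype.card (ι → Bool) : ℝ≥0∞) * (Fintype.card ι * δ)
        = ∑ _k : ι, (Fintype.card (ι → Bool)) * δ := by simp; ring
      _ ≤ ∑ k : ι, 2 * ∑ v : ι → Bool, ∫⁻ X, L k (v k) X ∂(P v) :=
          Finset.sum_le_sum fun k _ => h1 k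
      _ = 2 * ∑ v : ι → Bool, ∫⁻ X, ∑ k, L k (v k) X ∂(P v) := by
          rw [← Finset.mul_sum, Finset.sum_comm]
          congr 1
          exact Finset.sum_congr rfl fun v _ =>
            (lintegral_finsetSum _ fun k _ => hL k _).symm
      _ ≤ 2 * ∑ _v : ι → Bool, R := by gcongr with v; exact hR v
      _ = _ := by simp; ring
  rwa [ENNReal.mul_le_mul_iff_right (by simp) (by simp)] at h2

open scoped ContDiff

/-! ### Sums of rescaled bumps with separated centres -/

section PairwiseZero

variable {J : Type*} [Fintype J]

theorem eq_zero_or_exists_of_pairwise_zero {M : Type*} [AddCommMonoid M] {w : J → M}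
    (hw : ∀ i j, i ≠ j → w i = 0 ∨ w j = 0) :
    (∀ j, w j = 0) ∨ ∃ j, ∀ i, i ≠ j → w i = 0 := by
  by_cases h : ∀ j, w j = 0
  · exact Or.inl h
  · push Not at h
    obtain ⟨j, hj⟩ := h
    exact Or.inr ⟨j, fun i hi => (hw i j hi).resolve_right hj⟩

theorem apply_sum_of_pairwise_zero {F : ℝ → ℝ} (hF : F 0 = 0) {w : J → ℝ}
    (hw : ∀ i j, i ≠ j → w i = 0 ∨ w j = 0) : F (∑ j, w j) = ∑ j, F (w j) := by
  rcases eq_zero_or_exists_of_pairwise_zero hw with h | ⟨j, h⟩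
  · simp [h, hF]
  · rw [Fintype.sum_eq_single j h, Fintype.sum_eq_single j fun i hi => by rw [h i hi, hF]]

theorem norm_sum_le_of_pairwise_zero {V : Type*} [NormedAddCommGroup V] {w : J → V} {B : ℝ}
    (hB : 0 ≤ B) (hw : ∀ i j, i ≠ j → w i = 0 ∨ w j = 0) (h : ∀ j, ‖w j‖ ≤ B) :
    ‖∑ j, w j‖ ≤ B := by
  rcases eq_zero_or_exists_of_pairwise_zero hw with h0 | ⟨j, h0⟩
  · simpa [h0] using hB
  · rw [Fintype.sum_eq_single j h0]
    exact h j

end PairwiseZero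

section BumpSum

variable {V : Type*} [NormedAddCommGroup V] [NormedSpace ℝ V] {J : Type*} [Fintype J]

/-- The function `∑ⱼ σⱼ g (x / h - zⱼ)`: copies of the profile `g`, shrunk by the factor `h`, with
centres `h zⱼ` and weights `σⱼ`. -/
noncomputable def bumpSum (g : V → ℝ) (z : J → V) (σ : J → ℝ) (h : ℝ) (x : V) : ℝ :=
  ∑ j, σ j * g (h⁻¹ • x - z j)

theorem contDiff_bumpSum {g : V → ℝ} {n : WithTop ℕ∞} (hg : ContDiff ℝ n g) (z : J → V)
    (σ : J → ℝ) (h : ℝ) : ContDiff ℝ n (bumpSum g z σ h) := by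
  unfold bumpSum
  fun_prop

theorem hasFDerivAt_bumpSum {g : V → ℝ} (hg : Differentiable ℝ g) (z : J → V)
    (σ : J → ℝ) (h : ℝ) (x : V) :
    HasFDerivAt (bumpSum g z σ h) (∑ j, (σ j * h⁻¹) • fderiv ℝ g (h⁻¹ • x - z j)) x := by
  unfold bumpSum
  refine HasFDerivAt.fun_sum fun j _ => ?_
  have h1 : HasFDerivAt (fun x : V => h⁻¹ • x - z j) (h⁻¹ • ContinuousLinearMap.id ℝ V) x :=
    ((hasFDerivAt_id x).const_smul h⁻¹).sub_const _
  convert! ((hg (h⁻¹ • x - z j)).hasFDerivAt.comp x h1).const_mul (σ j) using 1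
  ext v
  simp [mul_assoc]

theorem pairwise_zero_of_tsupport_subset {V J M : Type*} [NormedAddCommGroup V] [Zero M]
    {g : V → M} {z : J → V}
    (hz : ∀ i j, i ≠ j → 1 ≤ ‖z i - z j‖) (hg : tsupport g ⊆ Metric.closedBall 0 (1 / 4))
    (y : V) {i j : J} (hij : i ≠ j) : g (y - z i) = 0 ∨ g (y - z j) = 0 := by
  by_contra! hcon
  have h1 := hg (subset_tsupport g hcon.1)
  have h2 := hg (subset_tsupport g hcon.2)
  rw [mem_closedBall_zero_iff] at h1 h2
  have h3 := hz i j hij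
  have h4 := norm_sub_le (y - z j) (y - z i)
  rw [sub_sub_sub_cancel_left] at h4
  linarith

theorem abs_bumpSum_le {g : V → ℝ} {z : J → V} (hz : ∀ i j, i ≠ j → 1 ≤ ‖z i - z j‖)
    (hg : tsupport g ⊆ Metric.closedBall 0 (1 / 4)) {σ : J → ℝ} (hσ : ∀ j, |σ j| ≤ 1) {B : ℝ}
    (hB : ∀ y, |g y| ≤ B) (h : ℝ) (x : V) : |bumpSum g z σ h x| ≤ B := by
  have hB0 : 0 ≤ B := (abs_nonneg _).trans (hB 0)
  refine norm_sum_le_of_pairwise_zero (V := ℝ) hB0 (fun i j hij => ?_) fun j => ?_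
  · rcases pairwise_zero_of_tsupport_subset hz hg (h⁻¹ • x) hij with h | h <;> simp [h]
  · rw [norm_mul]
    exact (mul_le_mul (hσ j) (hB _) (abs_nonneg _) zero_le_one).trans_eq (one_mul B)

theorem abs_bumpSum_sub_le {g : V → ℝ} (hgd : Differentiable ℝ g) {z : J → V}
    (hz : ∀ i j, i ≠ j → 1 ≤ ‖z i - z j‖)
    (hg : tsupport g ⊆ Metric.closedBall 0 (1 / 4)) {σ : J → ℝ} (hσ : ∀ j, |σ j| ≤ 1) {B : ℝ}
    (hB : ∀ y, ‖fderiv ℝ g y‖ ≤ B) {h : ℝ} (hh : 0 < h) (x y : V) :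
    |bumpSum g z σ h x - bumpSum g z σ h y| ≤ B * h⁻¹ * ‖x - y‖ := by
  have hB0 : 0 ≤ B := (norm_nonneg _).trans (hB 0)
  refine convex_univ.norm_image_sub_le_of_norm_fderiv_le (𝕜 := ℝ)
    (fun w _ => (hasFDerivAt_bumpSum hgd z σ h w).differentiableAt) (fun w _ => ?_)
    (Set.mem_univ _) (Set.mem_univ _)
  rw [(hasFDerivAt_bumpSum hgd z σ h w).fderiv]
  refine norm_sum_le_of_pairwise_zero (by positivity) (fun i j hij => ?_) fun j => ?_
  · rcases pairwise_zero_of_tsupport_subset (g := fderiv ℝ g) hz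
      ((tsupport_fderiv_subset ℝ).trans hg) (h⁻¹ • w) hij with h | h <;> simp [h]
  · rw [norm_smul, norm_mul, norm_inv, Real.norm_of_nonneg hh.le, mul_comm B]
    refine mul_le_mul ?_ (hB _) (norm_nonneg _) (by positivity)
    exact (mul_le_mul_of_nonneg_right (hσ j) (by positivity)).trans_eq (one_mul _)

/-- A function that is bounded by `B` and varies by at most `B` on the length scale `h` has
`α`-Hölder constant at most `2 B h ^ (-α)`. -/
theorem abs_sub_le_rpow_of_bounded_of_lipschitz {V : Type*} [NormedAddCommGroup V]
    {G : V → ℝ} {B h α : ℝ} (hh : 0 < h)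
    (hα0 : 0 ≤ α) (hα1 : α ≤ 1) (hB : ∀ x, |G x| ≤ B)
    (hL : ∀ x y, |G x - G y| ≤ B * h⁻¹ * ‖x - y‖) {x y : V} (hxy : x ≠ y) :
    |G x - G y| ≤ 2 * B * h ^ (-α) * ‖x - y‖ ^ α := by
  have hB0 : 0 ≤ B := (abs_nonneg _).trans (hB 0)
  have hn : 0 < ‖x - y‖ := norm_pos_iff.2 (sub_ne_zero.2 hxy)
  have key : h ^ (-α) * ‖x - y‖ ^ α = (h⁻¹ * ‖x - y‖) ^ α := by
    rw [Real.mul_rpow (by positivity) hn.le, Real.inv_rpow hh.le, Real.rpow_neg hh.le]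
  rw [mul_assoc, key]
  set t := h⁻¹ * ‖x - y‖
  have ht : 0 < t := by positivity
  rcases le_total 1 t with h1 | h1
  · have h2 : 1 ≤ t ^ α := Real.one_le_rpow h1 hα0
    have h3 := abs_sub (G x) (G y)
    nlinarith [hB x, hB y, mul_nonneg hB0 (sub_nonneg.2 h2)]
  · have h2 : t ≤ t ^ α := by
      simpa using Real.rpow_le_rpow_of_exponent_ge ht h1 hα1
    have h3 := hL x y
    rw [mul_assoc] at h3
    nlinarith [mul_nonneg hB0 (sub_nonneg.2 h2), mul_nonneg hB0 ht.le]

end BumpSum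

/-! ### Hölder norms of sums of rescaled bumps -/

section Holder

variable {d : ℕ}

theorem coordDeriv_mul_bumpSum {J : Type*} [Fintype J] {g : EuclideanSpace ℝ (Fin d) → ℝ}
    (hg : Differentiable ℝ g) (z : J → EuclideanSpace ℝ (Fin d)) (σ : J → ℝ) (h c : ℝ)
    (i : Fin d) :
    coordDeriv i (fun x => c * bumpSum g z σ h x)
      = fun x => c * h⁻¹ * bumpSum (coordDeriv i g) z σ h x := by
  funext x
  unfold coordDeriv
  rw [((hasFDerivAt_bumpSum hg z σ h x).const_mul c).fderiv]
  simp only [bumpSum, smul_apply, sum_apply, smul_eq_mul,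
    Finset.mul_sum]
  exact Finset.sum_congr rfl fun j _ => by ring

theorem contDiff_coordDeriv {g : EuclideanSpace ℝ (Fin d) → ℝ} (hg : ContDiff ℝ ∞ g) (i : Fin d) :
    ContDiff ℝ ∞ (coordDeriv i g) := by
  have : ContDiff ℝ ∞ (fderiv ℝ g) := hg.fderiv_right (by simp)
  exact this.clm_apply contDiff_const

/-- Iterated coordinate derivatives preserve every relation that a single one preserves; `r` keeps
track of the order. -/
theorem multiDeriv_induction
    {R : ℕ → (EuclideanSpace ℝ (Fin d) → ℝ) → (EuclideanSpace ℝ (Fin d) → ℝ) → Prop}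
    (step : ∀ r f g i, R r f g → R (r + 1) (coordDeriv i f) (coordDeriv i g))
    {f g : EuclideanSpace ℝ (Fin d) → ℝ} (h0 : R 0 f g) (ν : Fin d → ℕ) :
    R (∑ i, ν i) (multiDeriv ν f) (multiDeriv ν g) := by
  have hiter : ∀ i n r f g, R r f g → R (n + r) ((coordDeriv i)^[n] f) ((coordDeriv i)^[n] g) := by
    intro i n r f g h
    induction n with
    | zero => simpa using h
    | succ n ih =>
      rw [Function.iterate_succ_apply', Function.iterate_succ_apply', Nat.succ_add]
      exact step _ _ _ i ih
  have hlist : ∀ L : List (Fin d), R (L.map ν).sum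
      (L.foldr (fun i g => (coordDeriv i)^[ν i] g) f)
      (L.foldr (fun i g => (coordDeriv i)^[ν i] g) g) := by
    intro L
    induction L with
    | nil => simpa using h0
    | cons i L ih =>
      rw [List.map_cons, List.sum_cons]
      exact hiter i _ _ _ _ ih
  have := hlist (List.finRange d)
  rwa [← Fin.sum_univ_def] at this

theorem multiDeriv_profile {g : EuclideanSpace ℝ (Fin d) → ℝ} (hg : ContDiff ℝ ∞ g)
    (hs : tsupport g ⊆ Metric.closedBall 0 (1 / 4)) (ν : Fin d → ℕ) :
    ContDiff ℝ ∞ (multiDeriv ν g) ∧ tsupport (multiDeriv ν g) ⊆ Metric.closedBall 0 (1 / 4) :=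
  multiDeriv_induction
    (R := fun _ _ g => ContDiff ℝ ∞ g ∧ tsupport g ⊆ Metric.closedBall 0 (1 / 4))
    (fun _ _ _ i h => ⟨contDiff_coordDeriv h.1 i, (tsupport_fderiv_apply_subset ℝ _).trans h.2⟩)
    (f := g) ⟨hg, hs⟩ ν

theorem multiDeriv_mul_bumpSum {J : Type*} [Fintype J] {g : EuclideanSpace ℝ (Fin d) → ℝ}
    (hg : ContDiff ℝ ∞ g) (z : J → EuclideanSpace ℝ (Fin d)) (σ : J → ℝ) (h c : ℝ)
    (ν : Fin d → ℕ) :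
    multiDeriv ν (fun x => c * bumpSum g z σ h x)
      = fun x => c * h⁻¹ ^ (∑ i, ν i) * bumpSum (multiDeriv ν g) z σ h x := by
  refine (multiDeriv_induction (R := fun r f g => ContDiff ℝ ∞ g ∧
    f = fun x => c * h⁻¹ ^ r * bumpSum g z σ h x) (fun r f g i hR => ?_)
    ⟨hg, by simp⟩ ν).2
  refine ⟨contDiff_coordDeriv hR.1 i, ?_⟩
  rw [hR.2, coordDeriv_mul_bumpSum (hR.1.differentiable (by simp))]
  funext x
  ring

theorem exists_bound_multiDeriv {g : EuclideanSpace ℝ (Fin d) → ℝ} (hg : ContDiff ℝ ∞ g)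
    (hs : tsupport g ⊆ Metric.closedBall 0 (1 / 4)) (s : ℕ) :
    ∃ B : ℝ, 0 ≤ B ∧ ∀ ν : Fin d → ℕ, ∑ i, ν i ≤ s →
      ∀ y, |multiDeriv ν g y| ≤ B ∧ ‖fderiv ℝ (multiDeriv ν g) y‖ ≤ B := by
  have h1 : ∀ ν : Fin d → ℕ, ∃ B : ℝ, ∀ y, |multiDeriv ν g y| ≤ B ∧
      ‖fderiv ℝ (multiDeriv ν g) y‖ ≤ B := by
    intro ν
    obtain ⟨hc, ht⟩ := multiDeriv_profile hg hs ν
    have hcs : HasCompactSupport (multiDeriv ν g) :=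
      (isCompact_closedBall _ _).of_isClosed_subset (isClosed_tsupport _) ht
    obtain ⟨B₁, hB₁⟩ := hc.continuous.bounded_above_of_compact_support hcs
    obtain ⟨B₂, hB₂⟩ := (hc.continuous_fderiv (by simp)).bounded_above_of_compact_support
      (hcs.fderiv ℝ)
    exact ⟨max B₁ B₂, fun y => ⟨(hB₁ y).trans (le_max_left _ _), (hB₂ y).trans (le_max_right _ _)⟩⟩
  choose B hB using h1
  have hB0 : ∀ ν, 0 ≤ B ν := fun ν => (abs_nonneg _).trans (hB ν 0).1
  have hfin : ({ν : Fin d → ℕ | ∑ i, ν i ≤ s}).Finite := by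
    refine (Set.finite_Iic fun _ => s).subset fun ν hν i => ?_
    exact (Finset.single_le_sum (fun j _ => Nat.zero_le (ν j)) (Finset.mem_univ i)).trans hν
  refine ⟨∑ ν ∈ hfin.toFinset, B ν, Finset.sum_nonneg fun ν _ => hB0 ν, fun ν hν y => ?_⟩
  have hle : B ν ≤ ∑ ν ∈ hfin.toFinset, B ν :=
    Finset.single_le_sum (fun ν _ => hB0 ν) (hfin.mem_toFinset.2 hν)
  exact ⟨(hB ν y).1.trans hle, (hB ν y).2.trans hle⟩

/-- The scaling `h ^ η` makes the `η`-Hölder norm of a sum of bumps of width `h` bounded uniformly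
in `h`, in the number of bumps and in their weights. -/
theorem exists_holderENormOn_bumpSum_le {g : EuclideanSpace ℝ (Fin d) → ℝ}
    (hg : ContDiff ℝ ∞ g) (hs : tsupport g ⊆ Metric.closedBall 0 (1 / 4)) {η : ℝ} (hη : 0 < η) :
    ∃ ε₀ : ℝ, 0 < ε₀ ∧ ∀ ε : ℝ, 0 < ε → ε ≤ ε₀ → ∀ {J : Type} [Fintype J]
      {z : J → EuclideanSpace ℝ (Fin d)} {σ : J → ℝ} {h : ℝ}, 0 < h → h ≤ 1 →
      (∀ i j, i ≠ j → 1 ≤ ‖z i - z j‖) → (∀ j, |σ j| ≤ 1) →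
      holderENormOn η (fun x => ε * h ^ η * bumpSum g z σ h x) Set.univ ≤ 1 := by
  obtain ⟨B, hB0, hB⟩ := exists_bound_multiDeriv hg hs ⌊η⌋₊
  have hs0 : (⌊η⌋₊ : ℝ) ≤ η := Nat.floor_le hη.le
  have hs1 : η < ⌊η⌋₊ + 1 := Nat.lt_floor_add_one η
  set s := ⌊η⌋₊ with hsdef
  -- the number of suprema in the Hölder norm
  obtain ⟨M, hM⟩ : ∃ M : ℕ, M = ∑ k ∈ Finset.range (s + 1),
    (Finset.piAntidiag (Finset.univ : Finset (Fin d)) k).card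
      + (Finset.piAntidiag (Finset.univ : Finset (Fin d)) s).card := ⟨_, rfl⟩
  refine ⟨1 / (M * (2 * B) + 1), by positivity, fun ε hε hε0 J _ z σ h hh hh1 hz hσ => ?_⟩
  have hsup : ∀ k ≤ s, ∀ ν ∈ Finset.piAntidiag (Finset.univ : Finset (Fin d)) k,
      supENormOn (multiDeriv ν fun x => ε * h ^ η * bumpSum g z σ h x) Set.univ
        ≤ ENNReal.ofReal (ε * (2 * B)) := by
    intro k hk ν hν
    have hνk : ∑ i, ν i = k := (Finset.mem_piAntidiag.1 hν).1
    obtain ⟨-, ht⟩ := multiDeriv_profile hg hs ν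
    rw [multiDeriv_mul_bumpSum hg, hνk]
    refine iSup₂_le fun x _ => ENNReal.ofReal_le_ofReal ?_
    have h1 := abs_bumpSum_le hz ht hσ (fun y => (hB ν (hνk.trans_le hk) y).1) h x
    have h2 : h ^ η * h⁻¹ ^ k ≤ 1 := by
      have hk' : (k : ℝ) ≤ η := le_trans (by exact_mod_cast hk) hs0
      rw [inv_pow, ← Real.rpow_natCast, ← Real.rpow_neg hh.le, ← Real.rpow_add hh]
      exact Real.rpow_le_one hh.le hh1 (by linarith)
    rw [abs_mul, abs_of_nonneg (by positivity), mul_assoc ε, mul_assoc ε]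
    refine mul_le_mul_of_nonneg_left ?_ hε.le
    calc _ ≤ 1 * B := mul_le_mul h2 h1 (abs_nonneg _) zero_le_one
      _ ≤ 2 * B := by linarith
  have hsemi : ∀ ν ∈ Finset.piAntidiag (Finset.univ : Finset (Fin d)) s,
      holderESeminormOn (η - s) (multiDeriv ν fun x => ε * h ^ η * bumpSum g z σ h x) Set.univ
        ≤ ENNReal.ofReal (ε * (2 * B)) := by
    intro ν hν
    have hνk : ∑ i, ν i = s := (Finset.mem_piAntidiag.1 hν).1
    obtain ⟨hc, ht⟩ := multiDeriv_profile hg hs ν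
    rw [multiDeriv_mul_bumpSum hg, hνk]
    refine iSup₂_le fun x _ => iSup₂_le fun y _ => iSup_le fun hxy => ENNReal.ofReal_le_ofReal ?_
    have hn : 0 < ‖x - y‖ := norm_pos_iff.2 (sub_ne_zero.2 hxy)
    have h1 := abs_sub_le_rpow_of_bounded_of_lipschitz hh (sub_nonneg.2 hs0) (by linarith)
      (abs_bumpSum_le hz ht hσ (fun y => (hB ν hνk.le y).1) h)
      (abs_bumpSum_sub_le (hc.differentiable (by simp)) hz ht hσ
        (fun y => (hB ν hνk.le y).2) hh) hxy
    have h2 : h ^ η * h⁻¹ ^ s * h ^ (-(η - s)) = 1 := by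
      rw [inv_pow, ← Real.rpow_natCast, ← Real.rpow_neg hh.le, ← Real.rpow_add hh,
        ← Real.rpow_add hh, show η + -(s : ℝ) + -(η - s) = 0 by ring, Real.rpow_zero]
    rw [div_le_iff₀ (by positivity), ← mul_sub, abs_mul, abs_of_nonneg (by positivity)]
    calc _ ≤ ε * h ^ η * h⁻¹ ^ s * (2 * B * h ^ (-(η - s)) * ‖x - y‖ ^ (η - s)) := by gcongr
      _ = ε * (2 * B) * ‖x - y‖ ^ (η - s) * (h ^ η * h⁻¹ ^ s * h ^ (-(η - s))) := by ring
      _ = _ := by rw [h2, mul_one]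
  calc holderENormOn η (fun x => ε * h ^ η * bumpSum g z σ h x) Set.univ
      ≤ ∑ k ∈ Finset.range (s + 1), ∑ _ν ∈ Finset.piAntidiag (Finset.univ : Finset (Fin d)) k,
          ENNReal.ofReal (ε * (2 * B))
        + ∑ _ν ∈ Finset.piAntidiag (Finset.univ : Finset (Fin d)) s,
          ENNReal.ofReal (ε * (2 * B)) :=
        add_le_add (Finset.sum_le_sum fun k hk => Finset.sum_le_sum fun ν hν =>
          hsup k (Nat.lt_succ_iff.1 (Finset.mem_range.1 hk)) ν hν) (Finset.sum_le_sum hsemi)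
    _ = M * ENNReal.ofReal (ε * (2 * B)) := by
        simp only [Finset.sum_const, nsmul_eq_mul, ← Finset.sum_mul, ← add_mul, hM]
        push_cast
        rfl
    _ = ENNReal.ofReal (M * (ε * (2 * B))) := by
        rw [ENNReal.ofReal_mul (Nat.cast_nonneg M), ENNReal.ofReal_natCast]
    _ ≤ 1 := by
        rw [ENNReal.ofReal_le_one]
        have hpos : (0 : ℝ) < M * (2 * B) + 1 := by positivity
        calc M * (ε * (2 * B)) = ε * (M * (2 * B)) := by ring
          _ ≤ 1 / (M * (2 * B) + 1) * (M * (2 * B) + 1) := by gcongr; linarith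
          _ = 1 := by field_simp

end Holder

/-! ### Perturbed Gaussian densities belong to the model -/

section Quadratic

variable {V : Type*} [NormedAddCommGroup V] [InnerProductSpace ℝ V]

theorem hasFDerivAt_half_norm_sq_add (c : ℝ) (x : V) :
    HasFDerivAt (fun x : V => ‖x‖ ^ 2 / 2 + c) (innerSL ℝ x) x := by
  have h := (((hasStrictFDerivAt_norm_sq x).hasFDerivAt).const_mul (1 / 2 : ℝ)).add_const c
  convert! h using 1
  · funext y; ring
  · ext v; simp

theorem fderiv_half_norm_sq_add (c : ℝ) :
    fderiv ℝ (fun x : V => ‖x‖ ^ 2 / 2 + c) = (innerSL ℝ : V →L[ℝ] V →L[ℝ] ℝ) :=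
  funext fun x => (hasFDerivAt_half_norm_sq_add c x).fderiv

theorem fderiv_fderiv_half_norm_sq_add (c : ℝ) :
    fderiv ℝ (fderiv ℝ fun x : V => ‖x‖ ^ 2 / 2 + c)
      = fun _ => (innerSL ℝ : V →L[ℝ] V →L[ℝ] ℝ) := by
  rw [fderiv_half_norm_sq_add]
  funext x
  exact ContinuousLinearMap.fderiv _

/-- The three bounds are those for the orders `0`, `1` and `2`; higher derivatives vanish. -/
theorem norm_iteratedFDeriv_half_norm_sq_add_le {c : ℝ} (hc : 0 ≤ c) (k : ℕ) (x : V) :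
    ‖iteratedFDeriv ℝ k (fun x : V => ‖x‖ ^ 2 / 2 + c) x‖
      ≤ max (max (‖x‖ ^ 2 / 2 + c) ‖x‖) 1 := by
  match k with
  | 0 =>
    rw [norm_iteratedFDeriv_zero, Real.norm_of_nonneg (by positivity)]
    exact (le_max_left _ _).trans (le_max_left _ _)
  | 1 =>
    rw [← norm_iteratedFDeriv_fderiv, norm_iteratedFDeriv_zero, fderiv_half_norm_sq_add]
    refine le_trans (le_of_eq ?_) ((le_max_right _ _).trans (le_max_left _ _))
    exact innerSL_apply_norm ℝ x
  | k + 2 =>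
    rw [← norm_iteratedFDeriv_fderiv, ← norm_iteratedFDeriv_fderiv,
      fderiv_fderiv_half_norm_sq_add]
    refine le_trans ?_ (le_max_right _ _)
    rcases Nat.eq_zero_or_pos k with rfl | hk
    · rw [norm_iteratedFDeriv_zero]
      exact norm_innerSL_le ℝ (E := V)
    · rw [iteratedFDeriv_const_of_ne hk.ne']
      simp

/-- The growth condition for the potential `u = ‖·‖² / 2 + c`: within distance `1 / u x` of `x`, the
bound of `norm_iteratedFDeriv_half_norm_sq_add_le` is at most `1 + u x`. -/
theorem growth_half_norm_sq_add {V : Type*} [NormedAddCommGroup V] {c : ℝ} (hc : 2 ≤ c) {x y : V}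
    (hxy : ‖x - y‖ ≤ (‖x‖ ^ 2 / 2 + c)⁻¹) :
    max (max (‖y‖ ^ 2 / 2 + c) ‖y‖) 1 ≤ 1 + (‖x‖ ^ 2 / 2 + c) := by
  have hu : 0 < ‖x‖ ^ 2 / 2 + c := by positivity
  have hy : ‖y‖ ≤ ‖x‖ + ‖x - y‖ := by
    rw [norm_sub_rev]; simpa using norm_add_le x (y - x)
  set r := ‖x‖
  set t := ‖x - y‖
  have hr : 0 ≤ r := norm_nonneg _
  have ht : 0 ≤ t := norm_nonneg _
  have h1 : t * (r ^ 2 / 2 + c) ≤ 1 := by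
    calc _ ≤ (r ^ 2 / 2 + c)⁻¹ * (r ^ 2 / 2 + c) := by gcongr
      _ = 1 := inv_mul_cancel₀ hu.ne'
  -- `r² / 2 + 2 ≥ 2 r` bounds the cross term `r t` by `1 / 2`
  have h2 : r * t ≤ 1 / 2 := by nlinarith [mul_nonneg ht (sq_nonneg (r - 2))]
  have h3 : t ≤ 1 / 2 := by nlinarith [mul_nonneg ht (sq_nonneg r)]
  have h4 : ‖y‖ ^ 2 ≤ (r + t) ^ 2 := by gcongr
  refine max_le (max_le ?_ ?_) ?_
  · nlinarith
  · nlinarith [sq_nonneg (r - 1)]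
  · nlinarith [sq_nonneg r]

end Quadratic

/-- A Gaussian density times `exp a`, with a perturbation `a` from the unit Hölder ball, belongs to
the model for every `K ≥ 1`, provided that the normalising constant is at least `e²`. -/
theorem mem_densityModel_of_gaussian {d : ℕ} {β K : ℝ} (hK : 1 ≤ K)
    {a p : EuclideanSpace ℝ (Fin d) → ℝ} (ha : ContDiff ℝ ∞ a)
    (haH : holderENormOn β a Set.univ ≤ 1) {c : ℝ} (hc : 2 ≤ c)
    (hp : ∀ x, p x = Real.exp (-(‖x‖ ^ 2 / 2 + c) + a x)) (hprob : IsProbDensity p) :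
    p ∈ densityModel d β K := by
  have hsupp : Function.support p = Set.univ :=
    Set.eq_univ_of_forall fun x => by rw [Function.mem_support, hp]; exact (Real.exp_pos _).ne'
  set u : EuclideanSpace ℝ (Fin d) → WithTop ℝ := fun x => ((‖x‖ ^ 2 / 2 + c : ℝ) : WithTop ℝ)
    with hu
  have hfin : finitePart u = fun x => ‖x‖ ^ 2 / 2 + c := rfl
  refine ⟨hprob, u, a, ?_⟩
  constructor
  · intro x
    rw [hp, hfin, if_neg (WithTop.coe_ne_top)]
  · rw [hsupp]
    exact ⟨(ha.of_le (by exact_mod_cast le_top)).contDiffOn, haH.trans (by simpa using hK)⟩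
  · rw [hfin]
    have : ContDiff ℝ ∞ fun x : EuclideanSpace ℝ (Fin d) => ‖x‖ ^ 2 / 2 + c :=
      ((contDiff_norm_sq ℝ).div_const 2).add contDiff_const
    exact (this.of_le (by exact_mod_cast le_top)).contDiffOn
  · rw [hsupp]
    exact convex_univ
  · intro x _ v
    rw [hfin, iteratedFDeriv_two_apply, fderiv_fderiv_half_norm_sq_add]
    have h1 : (innerSL ℝ v : EuclideanSpace ℝ (Fin d) →L[ℝ] ℝ) v = ‖v‖ ^ 2 := by simp
    simp only [Matrix.cons_val_zero, Matrix.cons_val_one]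
    refine le_of_le_of_eq ?_ h1.symm
    exact mul_le_of_le_one_left (by positivity) (inv_le_one_of_one_le₀ hK)
  · refine ⟨0, ?_, by simp; linarith⟩
    ext x
    simp only [Set.mem_ofPred_eq, Set.mem_singleton_iff, hu, WithTop.coe_le_coe]
    constructor
    · intro h
      have := h 0
      simp only [norm_zero] at this
      have h2 : ‖x‖ ^ 2 ≤ 0 := by linarith
      exact norm_eq_zero.1 (pow_eq_zero_iff two_ne_zero |>.1 (le_antisymm h2 (sq_nonneg _)))
    · rintro rfl y
      simp only [norm_zero]
      have := sq_nonneg ‖y‖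
      linarith
  · intro x y _ hxy
    refine ⟨WithTop.coe_ne_top, fun k _ => ?_⟩
    rw [hfin] at hxy ⊢
    have hu1 : 1 ≤ ‖x‖ ^ 2 / 2 + c := by nlinarith [sq_nonneg ‖x‖]
    simp only [abs_of_nonneg (zero_le_one.trans hu1), max_eq_right hu1] at hxy ⊢
    set t := ‖x‖ ^ 2 / 2 + c
    have h1 : (K * t) ^ (-K) ≤ t⁻¹ := by
      rw [Real.rpow_neg (by positivity)]
      refine inv_anti₀ (by positivity) ?_
      have hKt : t ≤ K * t := le_mul_of_one_le_left (by positivity) hK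
      calc t ≤ K * t := hKt
        _ = (K * t) ^ (1 : ℝ) := (Real.rpow_one _).symm
        _ ≤ (K * t) ^ K := Real.rpow_le_rpow_of_exponent_le (hu1.trans hKt) hK
    have h2 : 1 + t ≤ K * (1 + t ^ K) := by
      have h3 : t ≤ t ^ K := by
        simpa using Real.rpow_le_rpow_of_exponent_le hu1 hK
      nlinarith
    exact (norm_iteratedFDeriv_half_norm_sq_add_le (by linarith) k y).trans
      ((growth_half_norm_sq_add hc (hxy.trans h1)).trans h2)

/-! ### The hypotheses: odd perturbations of a Gaussian density -/

section Hypotheses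

variable {d : ℕ} {ι : Type} [Fintype ι]

/-- A smooth radial bump with values in `[0, 1]`, supported in the ball of radius `1 / 4`. -/
noncomputable def unitBump (d : ℕ) : ContDiffBump (0 : EuclideanSpace ℝ (Fin d)) where
  rIn := 1 / 8
  rOut := 1 / 4
  rIn_pos := by norm_num
  rIn_lt_rOut := by norm_num

/-- The family `f` followed by `-f`. -/
def signed {ι M : Type*} [Neg M] (f : ι → M) : ι ⊕ ι → M := Sum.elim f fun k => -f k

/-- The perturbation `x ↦ κ ∑ₖ sₖ (ψ (x / h - zₖ) - ψ (x / h + zₖ))`. Every bump comes with its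
negative at the mirrored centre, which makes the function odd. -/
noncomputable def perturbation (z : ι → EuclideanSpace ℝ (Fin d)) (h κ : ℝ) (s : ι → ℝ)
    (x : EuclideanSpace ℝ (Fin d)) : ℝ :=
  κ * bumpSum (unitBump d) (signed z) (signed s) h x

theorem tsupport_unitBump : tsupport (unitBump d) ⊆ Metric.closedBall 0 (1 / 4) := by
  rw [ContDiffBump.tsupport_eq]
  rfl

theorem unitBump_eq_zero {y : EuclideanSpace ℝ (Fin d)} (hy : 1 / 4 ≤ ‖y‖) :
    unitBump d y = 0 :=
  (unitBump d).zero_of_le_dist (by simpa [unitBump] using hy)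

theorem contDiff_perturbation (z : ι → EuclideanSpace ℝ (Fin d)) (h κ : ℝ) (s : ι → ℝ) :
    ContDiff ℝ ∞ (perturbation z h κ s) :=
  contDiff_const.mul (contDiff_bumpSum (unitBump d).contDiff _ _ _)

theorem perturbation_neg (z : ι → EuclideanSpace ℝ (Fin d)) (h κ : ℝ) (s : ι → ℝ)
    (x : EuclideanSpace ℝ (Fin d)) : perturbation z h κ s (-x) = -perturbation z h κ s x := by
  have h1 : ∀ k, unitBump d (h⁻¹ • -x - z k) = unitBump d (h⁻¹ • x - -z k) := fun k => by
    rw [← ContDiffBump.neg]; congr 1; rw [smul_neg]; abel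
  have h2 : ∀ k, unitBump d (h⁻¹ • -x - -z k) = unitBump d (h⁻¹ • x - z k) := fun k => by
    rw [← ContDiffBump.neg]; congr 1; rw [smul_neg]; abel
  simp only [perturbation, bumpSum, signed, Fintype.sum_sum_type, Sum.elim_inl, Sum.elim_inr,
    h1, h2, neg_mul, Finset.sum_neg_distrib]
  ring

theorem perturbation_add_div_two (z : ι → EuclideanSpace ℝ (Fin d)) (h κ : ℝ) {s s' t : ι → ℝ}
    (ht : ∀ k, s k + s' k = 2 * t k) (x : EuclideanSpace ℝ (Fin d)) :
    perturbation z h κ s x + perturbation z h κ s' x = 2 * perturbation z h κ t x := by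
  simp only [perturbation, bumpSum]
  rw [← mul_add, ← Finset.sum_add_distrib, mul_left_comm 2 κ, Finset.mul_sum _ _ (2 : ℝ)]
  refine congrArg (κ * ·) (Finset.sum_congr rfl fun j _ => ?_)
  rw [← add_mul, ← mul_assoc]
  congr 1
  rcases j with k | k
  · exact ht k
  · simp only [signed, Sum.elim_inr]
    linarith [ht k]

theorem abs_signed_le {ι : Type*} {s : ι → ℝ} (hs : ∀ k, |s k| ≤ 1) (j : ι ⊕ ι) :
    |signed s j| ≤ 1 := by
  rcases j with k | k
  · exact hs k
  · simpa [signed] using hs k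

variable {z : ι → EuclideanSpace ℝ (Fin d)} {h κ : ℝ}

theorem abs_perturbation_le (hz : ∀ i j, i ≠ j → 1 ≤ ‖signed z i - signed z j‖) (hκ : 0 ≤ κ)
    {s : ι → ℝ} (hs : ∀ k, |s k| ≤ 1) (x : EuclideanSpace ℝ (Fin d)) :
    |perturbation z h κ s x| ≤ κ := by
  have h1 := abs_bumpSum_le hz tsupport_unitBump (abs_signed_le hs) (B := 1)
    (fun y => by rw [abs_of_nonneg (unitBump d).nonneg]; exact (unitBump d).le_one) h x
  rw [perturbation, abs_mul, abs_of_nonneg hκ]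
  exact mul_le_of_le_one_right hκ h1

theorem apply_perturbation (hz : ∀ i j, i ≠ j → 1 ≤ ‖signed z i - signed z j‖) {F : ℝ → ℝ}
    (hF : F 0 = 0) (s : ι → ℝ) (x : EuclideanSpace ℝ (Fin d)) :
    F (perturbation z h κ s x)
      = ∑ j, F (κ * (signed s j * unitBump d (h⁻¹ • x - signed z j))) := by
  rw [perturbation, bumpSum, Finset.mul_sum]
  refine apply_sum_of_pairwise_zero hF fun i j hij => ?_
  rcases pairwise_zero_of_tsupport_subset hz tsupport_unitBump (h⁻¹ • x) hij with h | h <;>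
    simp [h]

theorem cosh_perturbation_sub_one (hz : ∀ i j, i ≠ j → 1 ≤ ‖signed z i - signed z j‖)
    (s : ι → ℝ) (x : EuclideanSpace ℝ (Fin d)) :
    Real.cosh (perturbation z h κ s x) - 1
      = ∑ k, (Real.cosh (κ * (s k * unitBump d (h⁻¹ • x - z k))) - 1)
        + ∑ k, (Real.cosh (κ * (s k * unitBump d (h⁻¹ • x + z k))) - 1) := by
  rw [apply_perturbation hz (F := fun t => Real.cosh t - 1) (by simp), Fintype.sum_sum_type]
  simp [signed]

theorem cosh_mul_sign {t : ℝ} (ht : t = 1 ∨ t = -1) (a b : ℝ) :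
    Real.cosh (a * (t * b)) = Real.cosh (a * b) := by
  rcases ht with rfl | rfl <;> simp

theorem cosh_perturbation_eq (hz : ∀ i j, i ≠ j → 1 ≤ ‖signed z i - signed z j‖)
    {s : ι → ℝ} (hs : ∀ k, s k = 1 ∨ s k = -1) (x : EuclideanSpace ℝ (Fin d)) :
    Real.cosh (perturbation z h κ s x) = Real.cosh (perturbation z h κ (fun _ => 1) x) := by
  rw [← sub_left_inj (a := (1 : ℝ)), cosh_perturbation_sub_one hz, cosh_perturbation_sub_one hz]
  simp only [cosh_mul_sign (hs _), one_mul]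

/-- At a point of the cell of `zₖ` the perturbation only depends on the sign `sₖ`. -/
theorem perturbation_eq_of_unitBump_ne_zero
    (hz : ∀ i j, i ≠ j → 1 ≤ ‖signed z i - signed z j‖) (s : ι → ℝ) {k : ι}
    {x : EuclideanSpace ℝ (Fin d)} (hx : unitBump d (h⁻¹ • x - z k) ≠ 0) :
    perturbation z h κ s x = κ * (s k * unitBump d (h⁻¹ • x - z k)) := by
  rw [perturbation, bumpSum, Fintype.sum_eq_single (Sum.inl k)]
  · rfl
  · intro j hj
    rw [(pairwise_zero_of_tsupport_subset hz tsupport_unitBump (h⁻¹ • x) hj).resolve_right hx,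
      mul_zero]

/-- The density of the standard Gaussian distribution, up to its normalising constant. -/
noncomputable def gaussianWeight (x : EuclideanSpace ℝ (Fin d)) : ℝ := Real.exp (-(‖x‖ ^ 2 / 2))

theorem gaussianWeight_le_one (x : EuclideanSpace ℝ (Fin d)) : gaussianWeight x ≤ 1 :=
  Real.exp_le_one_iff.2 (by have := sq_nonneg ‖x‖; linarith)

theorem gaussianWeight_pos (x : EuclideanSpace ℝ (Fin d)) : 0 < gaussianWeight x :=
  Real.exp_pos _

theorem integral_gaussianWeight :
    ∫ x : EuclideanSpace ℝ (Fin d), gaussianWeight x = (2 * Real.pi) ^ ((d : ℝ) / 2) := by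
  have := GaussianFourier.integral_rexp_neg_mul_sq_norm (V := EuclideanSpace ℝ (Fin d))
    (b := 1 / 2) (by norm_num)
  rw [finrank_euclideanSpace_fin, show Real.pi / (1 / 2) = 2 * Real.pi by ring] at this
  rw [← this]
  refine integral_congr_ae (ae_of_all _ fun x => ?_)
  simp only [gaussianWeight]
  congr 1
  ring

theorem integrable_gaussianWeight :
    Integrable (gaussianWeight : EuclideanSpace ℝ (Fin d) → ℝ) := by
  refine Integrable.of_integral_ne_zero ?_
  rw [integral_gaussianWeight]
  positivity

theorem integrable_gaussianWeight_mul {f : EuclideanSpace ℝ (Fin d) → ℝ} (hf : Continuous f)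
    {C : ℝ} (hC : ∀ x, |f x| ≤ C) : Integrable fun x => gaussianWeight x * f x :=
  integrable_gaussianWeight.mul_bdd hf.aestronglyMeasurable (ae_of_all _ hC)

theorem abs_exp_le {t : ℝ} (ht : |t| ≤ 1) : |Real.exp t| ≤ Real.exp 1 := by
  rw [abs_of_pos (Real.exp_pos _)]
  exact Real.exp_le_exp.2 ((le_abs_self t).trans ht)

theorem cosh_sub_one_le_sq {t : ℝ} (ht : |t| ≤ 1) : Real.cosh t - 1 ≤ t ^ 2 := by
  have h2 : t ^ 2 ≤ 1 := by rw [← sq_abs]; exact pow_le_one₀ (abs_nonneg t) ht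
  have h3 := Real.abs_exp_sub_one_le (x := t ^ 2 / 2)
    (by rw [abs_of_nonneg (by positivity)]; linarith)
  rw [abs_of_nonneg (a := t ^ 2 / 2) (by positivity)] at h3
  linarith [Real.cosh_le_exp_half_sq t, le_abs_self (Real.exp (t ^ 2 / 2) - 1)]

theorem cosh_le_two {t : ℝ} (ht : |t| ≤ 1) : Real.cosh t ≤ 2 := by
  have h2 : t ^ 2 ≤ 1 := by rw [← sq_abs]; exact pow_le_one₀ (abs_nonneg t) ht
  linarith [cosh_sub_one_le_sq ht]

theorem integrable_gaussianWeight_mul_cosh {f : EuclideanSpace ℝ (Fin d) → ℝ} (hf : Continuous f)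
    (h1 : ∀ x, |f x| ≤ 1) : Integrable fun x => gaussianWeight x * Real.cosh (f x) :=
  integrable_gaussianWeight_mul (by fun_prop)
    fun x => by rw [abs_of_pos (Real.cosh_pos _)]; exact cosh_le_two (h1 x)

theorem integrable_gaussianWeight_mul_exp {f : EuclideanSpace ℝ (Fin d) → ℝ} (hf : Continuous f)
    (h1 : ∀ x, |f x| ≤ 1) : Integrable fun x => gaussianWeight x * Real.exp (f x) :=
  integrable_gaussianWeight_mul (by fun_prop) fun x => abs_exp_le (h1 x)

theorem integral_gaussianWeight_mul_exp_of_odd {f : EuclideanSpace ℝ (Fin d) → ℝ}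
    (hf : Continuous f) (h1 : ∀ x, |f x| ≤ 1) (hodd : ∀ x, f (-x) = -f x) :
    ∫ x, gaussianWeight x * Real.exp (f x) = ∫ x, gaussianWeight x * Real.cosh (f x) := by
  have h2 : ∫ x, gaussianWeight x * Real.exp (f x)
      = ∫ x, gaussianWeight x * Real.exp (-f x) := by
    rw [← integral_neg_eq_self]
    simp only [hodd]
    simp [gaussianWeight]
  have h3 : (∫ x, gaussianWeight x * Real.exp (f x)) + ∫ x, gaussianWeight x * Real.exp (-f x)
      = 2 * ∫ x, gaussianWeight x * Real.cosh (f x) := by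
    rw [← integral_add (integrable_gaussianWeight_mul_exp hf h1)
      (integrable_gaussianWeight_mul_exp (f := fun x => -f x) hf.neg
        fun x => by simpa using h1 x),
      ← integral_const_mul]
    refine integral_congr_ae (ae_of_all _ fun x => ?_)
    simp only [Real.cosh_eq]
    ring
  linarith

/-- The common normalising constant of all hypotheses. -/
noncomputable def normalizer (z : ι → EuclideanSpace ℝ (Fin d)) (h κ : ℝ) : ℝ :=
  ∫ x, gaussianWeight x * Real.cosh (perturbation z h κ (fun _ => 1) x)

/-- The density of the hypothesis with signs `s`. -/
noncomputable def hypothesisDensity (z : ι → EuclideanSpace ℝ (Fin d)) (h κ : ℝ) (s : ι → ℝ)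
    (x : EuclideanSpace ℝ (Fin d)) : ℝ :=
  Real.exp (-(‖x‖ ^ 2 / 2 + Real.log (normalizer z h κ)) + perturbation z h κ s x)

theorem continuous_hypothesisDensity (z : ι → EuclideanSpace ℝ (Fin d)) (h κ : ℝ) (s : ι → ℝ) :
    Continuous (hypothesisDensity z h κ s) := by
  have := (contDiff_perturbation z h κ s).continuous
  unfold hypothesisDensity
  fun_prop

theorem hypothesisDensity_nonneg (z : ι → EuclideanSpace ℝ (Fin d)) (h κ : ℝ) (s : ι → ℝ)
    (x : EuclideanSpace ℝ (Fin d)) : 0 ≤ hypothesisDensity z h κ s x :=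
  (Real.exp_pos _).le

/-- Since the perturbations are odd, `exp` may be replaced by `cosh` under the even Gaussian weight;
this removes the dependence on the signs. -/
theorem integral_gaussianWeight_mul_exp_perturbation
    (hz : ∀ i j, i ≠ j → 1 ≤ ‖signed z i - signed z j‖) (hκ : 0 ≤ κ) (hκ1 : κ ≤ 1)
    {s : ι → ℝ} (hs : ∀ k, s k = 1 ∨ s k = -1) :
    ∫ x, gaussianWeight x * Real.exp (perturbation z h κ s x) = normalizer z h κ := by
  have hs1 : ∀ k, |s k| ≤ 1 := fun k => by rcases hs k with h | h <;> simp [h]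
  rw [integral_gaussianWeight_mul_exp_of_odd (contDiff_perturbation z h κ s).continuous
    (fun x => (abs_perturbation_le hz hκ hs1 x).trans hκ1) (perturbation_neg z h κ s), normalizer]
  simp only [cosh_perturbation_eq hz hs]

theorem le_normalizer (hz : ∀ i j, i ≠ j → 1 ≤ ‖signed z i - signed z j‖) (hκ : 0 ≤ κ)
    (hκ1 : κ ≤ 1) : (2 * Real.pi) ^ ((d : ℝ) / 2) ≤ normalizer z h κ := by
  rw [← integral_gaussianWeight, normalizer]
  refine integral_mono integrable_gaussianWeight (integrable_gaussianWeight_mul_cosh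
    (contDiff_perturbation z h κ _).continuous
    fun x => (abs_perturbation_le hz hκ (by simp) x).trans hκ1) fun x => ?_
  exact le_mul_of_one_le_right (gaussianWeight_pos x).le (Real.one_le_cosh _)

theorem normalizer_le (hz : ∀ i j, i ≠ j → 1 ≤ ‖signed z i - signed z j‖) (hκ : 0 ≤ κ)
    (hκ1 : κ ≤ 1) : normalizer z h κ ≤ 2 * (2 * Real.pi) ^ ((d : ℝ) / 2) := by
  rw [← integral_gaussianWeight, normalizer, ← integral_const_mul]
  have h1 := fun x => (abs_perturbation_le (h := h) hz hκ (s := fun _ => 1) (by simp) x).trans hκ1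
  refine integral_mono (integrable_gaussianWeight_mul_cosh
    (contDiff_perturbation z h κ _).continuous h1) (integrable_gaussianWeight.const_mul 2)
    fun x => ?_
  simp only
  rw [mul_comm]
  exact mul_le_mul_of_nonneg_right (cosh_le_two (h1 x)) (gaussianWeight_pos x).le

theorem eight_le_two_pi_rpow (hd : 3 ≤ d) : 8 ≤ (2 * Real.pi) ^ ((d : ℝ) / 2) := by
  have h3 : (3 : ℝ) ≤ d := by exact_mod_cast hd
  calc (8 : ℝ) = (4 : ℝ) ^ ((3 : ℝ) / 2) := by
        rw [show (4 : ℝ) = 2 ^ (2 : ℝ) by norm_num, ← Real.rpow_mul (by norm_num)]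
        norm_num
    _ ≤ (4 : ℝ) ^ ((d : ℝ) / 2) := by gcongr; norm_num
    _ ≤ _ := by gcongr; linarith [Real.pi_gt_three]

theorem eight_le_normalizer (hd : 3 ≤ d) (hz : ∀ i j, i ≠ j → 1 ≤ ‖signed z i - signed z j‖)
    (hκ : 0 ≤ κ) (hκ1 : κ ≤ 1) : 8 ≤ normalizer z h κ :=
  (eight_le_two_pi_rpow hd).trans (le_normalizer hz hκ hκ1)

theorem hypothesisDensity_eq (hZ : 0 < normalizer z h κ) (s : ι → ℝ)
    (x : EuclideanSpace ℝ (Fin d)) :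
    hypothesisDensity z h κ s x
      = (normalizer z h κ)⁻¹ * (gaussianWeight x * Real.exp (perturbation z h κ s x)) := by
  rw [hypothesisDensity, neg_add, Real.exp_add, Real.exp_add, Real.exp_neg (Real.log _),
    Real.exp_log hZ, gaussianWeight]
  ring

theorem integrable_hypothesisDensity (hd : 3 ≤ d)
    (hz : ∀ i j, i ≠ j → 1 ≤ ‖signed z i - signed z j‖) (hκ : 0 ≤ κ) (hκ1 : κ ≤ 1)
    {s : ι → ℝ} (hs : ∀ k, |s k| ≤ 1) : Integrable (hypothesisDensity z h κ s) := by
  have hZ : 0 < normalizer z h κ := by linarith [eight_le_normalizer (h := h) hd hz hκ hκ1]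
  rw [funext (hypothesisDensity_eq hZ s)]
  exact (integrable_gaussianWeight_mul_exp (contDiff_perturbation z h κ s).continuous
    fun x => (abs_perturbation_le hz hκ hs x).trans hκ1).const_mul _

theorem isProbDensity_hypothesisDensity (hd : 3 ≤ d)
    (hz : ∀ i j, i ≠ j → 1 ≤ ‖signed z i - signed z j‖) (hκ : 0 ≤ κ) (hκ1 : κ ≤ 1)
    {s : ι → ℝ} (hs : ∀ k, s k = 1 ∨ s k = -1) :
    IsProbDensity (hypothesisDensity z h κ s) := by
  have hZ : 0 < normalizer z h κ := by linarith [eight_le_normalizer (h := h) hd hz hκ hκ1]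
  have hs1 : ∀ k, |s k| ≤ 1 := fun k => by rcases hs k with h | h <;> simp [h]
  refine ⟨(continuous_hypothesisDensity z h κ s).measurable, fun x => (Real.exp_pos _).le, ?_⟩
  rw [← ofReal_integral_eq_lintegral_ofReal (integrable_hypothesisDensity hd hz hκ hκ1 hs1)
    (ae_of_all _ fun x => (Real.exp_pos _).le)]
  simp only [hypothesisDensity_eq hZ]
  rw [integral_const_mul, integral_gaussianWeight_mul_exp_perturbation hz hκ hκ1 hs,
    inv_mul_cancel₀ hZ.ne', ENNReal.ofReal_one]

end Hypotheses

/-! ### Affinity and separation of neighbouring hypotheses -/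

section Neighbours

variable {d : ℕ} {ι : Type} [Fintype ι] {z : ι → EuclideanSpace ℝ (Fin d)} {h κ : ℝ}

theorem integral_comp_inv_smul_sub (f : EuclideanSpace ℝ (Fin d) → ℝ) (hh : 0 < h)
    (w : EuclideanSpace ℝ (Fin d)) : ∫ x, f (h⁻¹ • x - w) = h ^ d * ∫ y, f y := by
  rw [Measure.integral_comp_inv_smul_of_nonneg volume (fun y => f (y - w)) hh.le,
    integral_sub_right_eq_self, finrank_euclideanSpace_fin, smul_eq_mul]

theorem integrable_unitBump_comp (hh : 0 < h) (w : EuclideanSpace ℝ (Fin d)) :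
    Integrable fun x => unitBump d (h⁻¹ • x - w) := by
  have h1 : Integrable fun y : EuclideanSpace ℝ (Fin d) => unitBump d (y - w) :=
    ((unitBump d).continuous.integrable_of_hasCompactSupport
      (unitBump d).hasCompactSupport).comp_sub_right w
  exact h1.comp_smul (inv_ne_zero hh.ne')

/-- The mass of `cosh - 1` of one bump; it is quadratic in the amplitude. -/
theorem integral_gaussianWeight_mul_cosh_bump_le (hh : 0 < h) (hκ : 0 ≤ κ) (hκ1 : κ ≤ 1) {t : ℝ}
    (ht : |t| ≤ 1) (w : EuclideanSpace ℝ (Fin d)) :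
    Integrable (fun x => gaussianWeight x *
      (Real.cosh (κ * (t * unitBump d (h⁻¹ • x - w))) - 1)) ∧
    ∫ x, gaussianWeight x * (Real.cosh (κ * (t * unitBump d (h⁻¹ • x - w))) - 1)
      ≤ κ ^ 2 * (h ^ d * ∫ y, unitBump d y) := by
  have hψ : ∀ x, |κ * (t * unitBump d (h⁻¹ • x - w))| ≤ κ := fun x => by
    rw [abs_mul, abs_mul, abs_of_nonneg hκ, abs_of_nonneg (unitBump d).nonneg]
    exact mul_le_of_le_one_right hκ
      (mul_le_one₀ ht (unitBump d).nonneg (unitBump d).le_one)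
  have hc : Continuous fun x => Real.cosh (κ * (t * unitBump d (h⁻¹ • x - w))) - 1 := by
    have := (unitBump d).continuous
    fun_prop
  have h1 : ∀ x, Real.cosh (κ * (t * unitBump d (h⁻¹ • x - w))) - 1
      ≤ κ ^ 2 * unitBump d (h⁻¹ • x - w) := fun x => by
    refine (cosh_sub_one_le_sq ((hψ x).trans hκ1)).trans ?_
    have h2 := (unitBump d).nonneg (x := h⁻¹ • x - w)
    have h3 := (unitBump d).le_one (x := h⁻¹ • x - w)
    have h4 : t ^ 2 ≤ 1 := by rw [← sq_abs]; exact pow_le_one₀ (abs_nonneg t) ht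
    rw [mul_pow, mul_pow]
    refine mul_le_mul_of_nonneg_left ?_ (sq_nonneg κ)
    calc _ ≤ 1 * unitBump d (h⁻¹ • x - w) ^ 2 := by gcongr
      _ ≤ _ := by nlinarith
  have h0 : ∀ x, 0 ≤ Real.cosh (κ * (t * unitBump d (h⁻¹ • x - w))) - 1 := fun x =>
    sub_nonneg.2 (Real.one_le_cosh _)
  have hint : Integrable (fun x => gaussianWeight x *
      (Real.cosh (κ * (t * unitBump d (h⁻¹ • x - w))) - 1)) := by
    refine integrable_gaussianWeight_mul hc (C := 1) fun x => ?_
    rw [abs_of_nonneg (h0 x)]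
    linarith [cosh_le_two ((hψ x).trans hκ1)]
  refine ⟨hint, ?_⟩
  rw [← integral_comp_inv_smul_sub _ hh w, ← integral_const_mul]
  refine integral_mono hint ((integrable_unitBump_comp hh w).const_mul _) fun x => ?_
  exact (mul_le_of_le_one_left (h0 x) (gaussianWeight_le_one x)).trans (h1 x)

theorem sqrt_hypothesisDensity_mul [DecidableEq ι] (s : ι → ℝ) (k : ι)
    (x : EuclideanSpace ℝ (Fin d)) :
    √(hypothesisDensity z h κ s x * hypothesisDensity z h κ (Function.update s k (-s k)) x)
      = hypothesisDensity z h κ (Function.update s k 0) x := by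
  have h1 : perturbation z h κ s x + perturbation z h κ (Function.update s k (-s k)) x
      = 2 * perturbation z h κ (Function.update s k 0) x := by
    refine perturbation_add_div_two z h κ (fun i => ?_) x
    rcases eq_or_ne i k with rfl | hi
    · simp
    · simp only [Function.update_of_ne hi]
      ring
  rw [Real.sqrt_eq_iff_mul_self_eq (mul_nonneg (hypothesisDensity_nonneg ..)
    (hypothesisDensity_nonneg ..)) (hypothesisDensity_nonneg ..)]
  simp only [hypothesisDensity]
  rw [← Real.exp_add, ← Real.exp_add]
  congr 1
  linarith

/-- The Hellinger affinity of two neighbouring hypotheses is `1 - O(κ² h ^ d)`: the average of their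
perturbations is the perturbation without the bumps of index `k`. -/
theorem affinity_ge [DecidableEq ι] (hd : 3 ≤ d)
    (hz : ∀ i j, i ≠ j → 1 ≤ ‖signed z i - signed z j‖)
    (hh : 0 < h) (hκ : 0 ≤ κ) (hκ1 : κ ≤ 1) {s : ι → ℝ} (hs : ∀ k, s k = 1 ∨ s k = -1) (k : ι) :
    Integrable (fun x => √(hypothesisDensity z h κ s x *
      hypothesisDensity z h κ (Function.update s k (-s k)) x)) ∧
    1 - κ ^ 2 * (h ^ d * ∫ y, unitBump d y)
      ≤ ∫ x, √(hypothesisDensity z h κ s x *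
          hypothesisDensity z h κ (Function.update s k (-s k)) x) := by
  have hZ8 : 8 ≤ normalizer z h κ := eight_le_normalizer hd hz hκ hκ1
  have hZ : 0 < normalizer z h κ := by linarith
  have hs1 : ∀ k, |s k| ≤ 1 := fun k => by rcases hs k with h | h <;> simp [h]
  set t := Function.update s k 0 with ht
  have ht1 : ∀ k, |t k| ≤ 1 := fun i => by
    rcases eq_or_ne i k with rfl | hi
    · simp [ht]
    · rw [ht, Function.update_of_ne hi]; exact hs1 i
  simp only [sqrt_hypothesisDensity_mul]
  refine ⟨integrable_hypothesisDensity hd hz hκ hκ1 ht1, ?_⟩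
  have hcs := (contDiff_perturbation z h κ s).continuous
  have hct := (contDiff_perturbation z h κ t).continuous
  have hbs := fun x => (abs_perturbation_le (h := h) hz hκ hs1 x).trans hκ1
  have hbt := fun x => (abs_perturbation_le (h := h) hz hκ ht1 x).trans hκ1
  -- only the two bumps of index `k` contribute to the difference
  have hdiff : ∀ x, Real.cosh (perturbation z h κ s x) - Real.cosh (perturbation z h κ t x)
      = (Real.cosh (κ * (s k * unitBump d (h⁻¹ • x - z k))) - 1)
        + (Real.cosh (κ * (s k * unitBump d (h⁻¹ • x - -z k))) - 1) := fun x => by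
    rw [← sub_sub_sub_cancel_right _ _ (1 : ℝ), cosh_perturbation_sub_one hz,
      cosh_perturbation_sub_one hz, add_sub_add_comm, ← Finset.sum_sub_distrib,
      ← Finset.sum_sub_distrib, Fintype.sum_eq_single k, Fintype.sum_eq_single k]
    · simp [ht]
    · intro i hi; simp [ht, Function.update_of_ne hi]
    · intro i hi; simp [ht, Function.update_of_ne hi]
  have hZs : normalizer z h κ = ∫ x, gaussianWeight x * Real.cosh (perturbation z h κ s x) := by
    rw [← integral_gaussianWeight_mul_exp_perturbation hz hκ hκ1 hs]
    exact integral_gaussianWeight_mul_exp_of_odd hcs hbs (perturbation_neg z h κ s)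
  obtain ⟨hi1, hle1⟩ := integral_gaussianWeight_mul_cosh_bump_le hh hκ hκ1 (hs1 k) (z k)
  obtain ⟨hi2, hle2⟩ := integral_gaussianWeight_mul_cosh_bump_le hh hκ hκ1 (hs1 k) (-z k)
  have hgap : normalizer z h κ
      - ∫ x, gaussianWeight x * Real.cosh (perturbation z h κ t x)
      ≤ 2 * (κ ^ 2 * (h ^ d * ∫ y, unitBump d y)) := by
    rw [hZs, ← integral_sub (integrable_gaussianWeight_mul_cosh hcs hbs)
      (integrable_gaussianWeight_mul_cosh hct hbt)]
    simp only [← mul_sub, hdiff]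
    simp only [mul_add]
    rw [integral_add hi1 hi2]
    linarith
  have hD : 0 ≤ κ ^ 2 * (h ^ d * ∫ y, unitBump d y) :=
    mul_nonneg (sq_nonneg κ) (mul_nonneg (by positivity)
      (integral_nonneg fun y => (unitBump d).nonneg))
  simp only [hypothesisDensity_eq hZ]
  rw [integral_const_mul, integral_gaussianWeight_mul_exp_of_odd hct hbt
    (perturbation_neg z h κ t), inv_mul_eq_div, le_div_iff₀ hZ]
  -- the factor `2` of the two bumps is absorbed by the normalising constant
  nlinarith

/-- The integral of the `k`-th test function `x ↦ c ψ (x / h - zₖ)` under a hypothesis whose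
`k`-th sign is `b`. -/
noncomputable def cellMean (z : ι → EuclideanSpace ℝ (Fin d)) (h κ c : ℝ) (k : ι) (b : ℝ) : ℝ :=
  ∫ x, c * unitBump d (h⁻¹ • x - z k) *
    ((normalizer z h κ)⁻¹ *
      (gaussianWeight x * Real.exp (κ * (b * unitBump d (h⁻¹ • x - z k)))))

theorem integral_densityLaw_eq_cellMean (hd : 3 ≤ d)
    (hz : ∀ i j, i ≠ j → 1 ≤ ‖signed z i - signed z j‖) (hκ : 0 ≤ κ) (hκ1 : κ ≤ 1)
    (s : ι → ℝ) (c : ℝ) (k : ι) :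
    ∫ x, c * unitBump d (h⁻¹ • x - z k) ∂(densityLaw (hypothesisDensity z h κ s))
      = cellMean z h κ c k (s k) := by
  have hZ : 0 < normalizer z h κ := by linarith [eight_le_normalizer (h := h) hd hz hκ hκ1]
  rw [densityLaw, integral_withDensity_eq_integral_toReal_smul
    (by have := (continuous_hypothesisDensity z h κ s).measurable; fun_prop)
    (ae_of_all _ fun _ => ENNReal.ofReal_lt_top), cellMean]
  refine integral_congr_ae (ae_of_all _ fun x => ?_)
  simp only [smul_eq_mul]
  rw [ENNReal.toReal_ofReal (hypothesisDensity_nonneg ..), mul_comm]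
  by_cases hx : unitBump d (h⁻¹ • x - z k) = 0
  · simp [hx]
  · rw [hypothesisDensity_eq hZ, perturbation_eq_of_unitBump_ne_zero hz s hx]

theorem integral_unitBump_sq_pos : 0 < ∫ y, unitBump d y ^ 2 := by
  have hc : Continuous fun y => unitBump d y ^ 2 := (unitBump d).continuous.pow 2
  have hs : HasCompactSupport fun y => unitBump d y ^ 2 :=
    (unitBump d).hasCompactSupport.comp_left (g := fun t : ℝ => t ^ 2) (by simp)
  refine hc.integral_pos_of_hasCompactSupport_nonneg_nonzero hs (x := 0)
    (fun y => sq_nonneg _) ?_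
  have : unitBump d 0 = 1 := (unitBump d).one_of_mem_closedBall (by simp [unitBump])
  simp [this]

/-- Flipping the sign of a cell changes the mean of its test function by order `c κ h ^ d`. -/
theorem cellMean_sub_ge (hd : 3 ≤ d) (hz : ∀ i j, i ≠ j → 1 ≤ ‖signed z i - signed z j‖)
    (hh : 0 < h) (hh1 : h ≤ 1) (hκ : 0 ≤ κ) (hκ1 : κ ≤ 1) {c : ℝ} (hc : 0 ≤ c) {k : ι} {r : ℝ}
    (hr : h * ‖z k‖ ≤ r) :
    c * κ * h ^ d * ((2 * (2 * Real.pi) ^ ((d : ℝ) / 2))⁻¹ *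
        (2 * Real.exp (-((r + 1) ^ 2 / 2)) * ∫ y, unitBump d y ^ 2))
      ≤ cellMean z h κ c k 1 - cellMean z h κ c k (-1) := by
  have hZ : 0 < normalizer z h κ := by linarith [eight_le_normalizer (h := h) hd hz hκ hκ1]
  have hψc : Continuous fun x => unitBump d (h⁻¹ • x - z k) := by
    have := (unitBump d).continuous
    fun_prop
  have hψ0 : ∀ x, 0 ≤ unitBump d (h⁻¹ • x - z k) := fun x => (unitBump d).nonneg
  have hψ1 : ∀ x, unitBump d (h⁻¹ • x - z k) ≤ 1 := fun x => (unitBump d).le_one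
  have hbound : ∀ b : ℝ, |b| ≤ 1 → ∀ x, |κ * (b * unitBump d (h⁻¹ • x - z k))| ≤ 1 := by
    intro b hb x
    rw [abs_mul, abs_mul, abs_of_nonneg hκ, abs_of_nonneg (hψ0 x)]
    exact mul_le_one₀ hκ1 (mul_nonneg (abs_nonneg b) (hψ0 x))
      (mul_le_one₀ hb (hψ0 x) (hψ1 x))
  have hint : ∀ b : ℝ, |b| ≤ 1 → Integrable fun x => c * unitBump d (h⁻¹ • x - z k) *
      ((normalizer z h κ)⁻¹ *
        (gaussianWeight x * Real.exp (κ * (b * unitBump d (h⁻¹ • x - z k))))) := by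
    intro b hb
    refine Integrable.bdd_mul (c := c) ((integrable_gaussianWeight_mul_exp
      (by fun_prop) (hbound b hb)).const_mul _)
      (hψc.const_mul c).aestronglyMeasurable (ae_of_all _ fun x => ?_)
    rw [norm_mul, Real.norm_of_nonneg hc, Real.norm_of_nonneg (hψ0 x)]
    exact mul_le_of_le_one_right hc (hψ1 x)
  have hsq : Integrable fun x => unitBump d (h⁻¹ • x - z k) ^ 2 := by
    refine (integrable_unitBump_comp hh (z k)).mono' (hψc.pow 2).aestronglyMeasurable
      (ae_of_all _ fun x => ?_)
    rw [Real.norm_of_nonneg (sq_nonneg _), pow_two]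
    exact mul_le_of_le_one_left (hψ0 x) (hψ1 x)
  have hstep : ∫ x, c * (normalizer z h κ)⁻¹ * (2 * κ * Real.exp (-((r + 1) ^ 2 / 2))) *
        unitBump d (h⁻¹ • x - z k) ^ 2
      ≤ cellMean z h κ c k 1 - cellMean z h κ c k (-1) := by
    rw [cellMean, cellMean, ← integral_sub (hint 1 (by simp)) (hint (-1) (by simp))]
    refine integral_mono (hsq.const_mul _) ((hint 1 (by simp)).sub (hint (-1) (by simp)))
      fun x => ?_
    simp only
    set ψ := unitBump d (h⁻¹ • x - z k) with hψ
    have hp : 0 ≤ ψ := hψ0 x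
    -- `exp t - exp (-t) = 2 sinh t ≥ 2 t`
    have h1 : 2 * (κ * ψ) ≤ Real.exp (κ * (1 * ψ)) - Real.exp (κ * (-1 * ψ)) := by
      have := Real.self_le_sinh_iff.2 (mul_nonneg hκ hp)
      rw [Real.sinh_eq] at this
      rw [one_mul, neg_one_mul, mul_neg]
      linarith
    have h2 : Real.exp (-((r + 1) ^ 2 / 2)) * ψ ≤ gaussianWeight x * ψ := by
      by_cases hx : ψ = 0
      · simp [hx]
      have hx1 : ‖h⁻¹ • x - z k‖ < 1 / 4 := by
        by_contra hcon
        exact hx (unitBump_eq_zero (not_lt.1 hcon))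
      have hx2 : ‖x‖ ≤ r + 1 := by
        have h3 : x = h • (h⁻¹ • x - z k) + h • z k := by
          rw [← smul_add, sub_add_cancel, smul_inv_smul₀ hh.ne']
        rw [h3]
        refine (norm_add_le _ _).trans ?_
        rw [norm_smul, norm_smul, Real.norm_of_nonneg hh.le]
        nlinarith [norm_nonneg (h⁻¹ • x - z k)]
      refine mul_le_mul_of_nonneg_right (Real.exp_le_exp.2 ?_) hp
      have : ‖x‖ ^ 2 ≤ (r + 1) ^ 2 := by gcongr
      linarith
    have hg := (gaussianWeight_pos x).le
    have hi : 0 ≤ (normalizer z h κ)⁻¹ := by positivity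
    calc c * (normalizer z h κ)⁻¹ * (2 * κ * Real.exp (-((r + 1) ^ 2 / 2))) * ψ ^ 2
        = c * (normalizer z h κ)⁻¹ * ((Real.exp (-((r + 1) ^ 2 / 2)) * ψ) * (2 * (κ * ψ))) := by
          ring
      _ ≤ c * (normalizer z h κ)⁻¹ * ((gaussianWeight x * ψ) *
            (Real.exp (κ * (1 * ψ)) - Real.exp (κ * (-1 * ψ)))) := by gcongr
      _ = _ := by ring
  refine le_trans ?_ hstep
  rw [integral_const_mul, integral_comp_inv_smul_sub (fun y => unitBump d y ^ 2) hh]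
  have hI := (integral_unitBump_sq_pos (d := d)).le
  have hZi : (2 * (2 * Real.pi) ^ ((d : ℝ) / 2))⁻¹ ≤ (normalizer z h κ)⁻¹ :=
    inv_anti₀ hZ (normalizer_le hz hκ hκ1)
  calc _ = (2 * (2 * Real.pi) ^ ((d : ℝ) / 2))⁻¹ * (c * (2 * κ * Real.exp (-((r + 1) ^ 2 / 2)))
        * (h ^ d * ∫ y, unitBump d y ^ 2)) := by ring
    _ ≤ (normalizer z h κ)⁻¹ * (c * (2 * κ * Real.exp (-((r + 1) ^ 2 / 2)))
        * (h ^ d * ∫ y, unitBump d y ^ 2)) := by gcongr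
    _ = _ := by ring

end Neighbours

/-! ### Lower bounds on the Wasserstein distance -/

/-- Test functions whose signed combinations are all `1`-Lipschitz bound `W₁` from below by the sum
of the absolute differences of their means. -/
theorem sum_abs_sub_le_wassersteinOne {d : ℕ} {ι : Type*} [Fintype ι]
    {P Q : Measure (EuclideanSpace ℝ (Fin d))} {f : ι → EuclideanSpace ℝ (Fin d) → ℝ}
    (hLip : ∀ τ : ι → ℝ, (∀ k, |τ k| ≤ 1) → LipschitzWith 1 fun x => ∑ k, τ k * f k x)
    (hP : ∀ k, Integrable (f k) P) (hQ : ∀ k, Integrable (f k) Q) :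
    ENNReal.ofReal (∑ k, |(∫ x, f k x ∂P) - ∫ x, f k x ∂Q|) ≤ wassersteinOne P Q := by
  set τ : ι → ℝ := fun k => if 0 ≤ (∫ x, f k x ∂P) - ∫ x, f k x ∂Q then 1 else -1 with hτ
  have hτ1 : ∀ k, |τ k| ≤ 1 := fun k => by simp only [hτ]; split_ifs <;> simp
  have hτm : ∀ k, |(∫ x, f k x ∂P) - ∫ x, f k x ∂Q|
      = τ k * ∫ x, f k x ∂P - τ k * ∫ x, f k x ∂Q := fun k => by
    simp only [hτ]
    split_ifs with h0
    · rw [abs_of_nonneg h0]; ring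
    · rw [abs_of_neg (not_le.1 h0)]; ring
  have hP' := fun k => (hP k).const_mul (τ k)
  have hQ' := fun k => (hQ k).const_mul (τ k)
  refine le_trans (le_of_eq ?_) (le_iSup₂_of_le _ (hLip τ hτ1) (le_iSup₂_of_le
    (integrable_finsetSum _ fun k _ => hP' k) (integrable_finsetSum _ fun k _ => hQ' k) le_rfl))
  rw [integral_finsetSum _ fun k _ => hP' k, integral_finsetSum _ fun k _ => hQ' k,
    ← Finset.sum_sub_distrib]
  simp only [integral_const_mul, hτm]

/-! ### The minimax bound for a given family of cells -/

/-- The lower bound on the minimax risk given by hypotheses that are indexed by signs on the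
cells. The assumption `hn` keeps the `n`-fold affinity of neighbours above `3 / 4`. -/
theorem le_wassersteinMinimaxRisk {d n : ℕ} {β K : ℝ} {ι : Type} [Fintype ι]
    {z : ι → EuclideanSpace ℝ (Fin d)} {h κ : ℝ} (hd : 3 ≤ d)
    (hz : ∀ i j, i ≠ j → 1 ≤ ‖signed z i - signed z j‖) (hh : 0 < h) (hh1 : h ≤ 1) (hκ : 0 ≤ κ)
    (hκ1 : κ ≤ 1)
    (hmem : ∀ s : ι → ℝ, (∀ k, s k = 1 ∨ s k = -1) →
      hypothesisDensity z h κ s ∈ densityModel d β K)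
    (hn : n * (κ ^ 2 * (h ^ d * ∫ y, unitBump d y)) ≤ 1 / 4)
    {L : ℝ} (hL : 0 < L) (hψL : ∀ y, ‖fderiv ℝ (unitBump d) y‖ ≤ L) {r : ℝ}
    (hr : ∀ k, h * ‖z k‖ ≤ r) :
    ENNReal.ofReal (Fintype.card ι * (h / L * κ * h ^ d *
        ((2 * (2 * Real.pi) ^ ((d : ℝ) / 2))⁻¹ *
          (2 * Real.exp (-((r + 1) ^ 2 / 2)) * ∫ y, unitBump d y ^ 2))) / 8)
      ≤ wassersteinMinimaxRisk d n β K := by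
  classical
  refine le_iInf₂ fun T hT => ?_
  set R := ⨆ p ∈ densityModel d β K,
      ∫⁻ X, wassersteinOne (densityLaw p) (T X) ∂(Measure.pi fun _ : Fin n => densityLaw p)
  set C := (2 * (2 * Real.pi) ^ ((d : ℝ) / 2))⁻¹ *
          (2 * Real.exp (-((r + 1) ^ 2 / 2)) * ∫ y, unitBump d y ^ 2) with hC
  set Δ := h / L * κ * h ^ d * C with hΔdef
  have hΔ : 0 ≤ Δ := by
    have := (integral_unitBump_sq_pos (d := d)).le
    positivity
  let sgn : Bool → ℝ := fun b => if b then 1 else -1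
  have hsgn : ∀ b, sgn b = 1 ∨ sgn b = -1 := fun b => by cases b <;> simp [sgn]
  let s : (ι → Bool) → ι → ℝ := fun v k => sgn (v k)
  have hs : ∀ v k, s v k = 1 ∨ s v k = -1 := fun v k => hsgn _
  have hsflip : ∀ v k, s (Function.update v k (!v k)) = Function.update (s v) k (-s v k) := by
    intro v k
    funext i
    rcases eq_or_ne i k with rfl | hi
    · cases hv : v i <;> simp [s, sgn, hv]
    · simp [s, Function.update_of_ne hi]
  have hprob : ∀ v, IsProbDensity (hypothesisDensity z h κ (s v)) := fun v =>
    isProbDensity_hypothesisDensity hd hz hκ hκ1 (hs v)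
  have hlaw : ∀ v, IsProbabilityMeasure (densityLaw (hypothesisDensity z h κ (s v))) := fun v =>
    ⟨by rw [densityLaw, withDensity_apply _ MeasurableSet.univ, Measure.restrict_univ,
      (hprob v).lintegral_eq_one]⟩
  -- the test functions
  let f : ι → EuclideanSpace ℝ (Fin d) → ℝ := fun k x => h / L * unitBump d (h⁻¹ • x - z k)
  have hfc : ∀ k, Continuous (f k) := fun k => by
    have := (unitBump d).continuous
    fun_prop
  have hfi : ∀ k (Q : Measure (EuclideanSpace ℝ (Fin d))) [IsProbabilityMeasure Q],
      Integrable (f k) Q := fun k Q _ => by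
    refine Integrable.of_bound (hfc k).aestronglyMeasurable (h / L) (ae_of_all _ fun x => ?_)
    rw [norm_mul, Real.norm_of_nonneg (by positivity), Real.norm_of_nonneg (unitBump d).nonneg]
    exact mul_le_of_le_one_right (by positivity) (unitBump d).le_one
  have hfL : ∀ τ : ι → ℝ, (∀ k, |τ k| ≤ 1) → LipschitzWith 1 fun x => ∑ k, τ k * f k x := by
    intro τ hτ
    have hzz : ∀ i j, i ≠ j → 1 ≤ ‖z i - z j‖ := fun i j hij =>
      hz (Sum.inl i) (Sum.inl j) (by simpa using hij)
    have hsum : ∀ x, ∑ k, τ k * f k x = h / L * bumpSum (unitBump d) z τ h x := fun x => by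
      rw [bumpSum, Finset.mul_sum]
      exact Finset.sum_congr rfl fun k _ => mul_left_comm _ _ _
    refine LipschitzWith.of_dist_le_mul fun x y => ?_
    have h1 := abs_bumpSum_sub_le ((unitBump d).contDiff.differentiable one_ne_zero) hzz
      tsupport_unitBump hτ hψL hh x y
    simp only [hsum]
    rw [Real.dist_eq, dist_eq_norm, ← mul_sub, abs_mul, abs_of_nonneg (by positivity)]
    calc _ ≤ h / L * (L * h⁻¹ * ‖x - y‖) := by gcongr
      _ = _ := by rw [NNReal.coe_one]; field_simp
  let loss : ι → Bool → (Fin n → EuclideanSpace ℝ (Fin d)) → ℝ≥0∞ := fun k b X =>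
    ENNReal.ofReal |cellMean z h κ (h / L) k (sgn b) - ∫ x, f k x ∂(T X)|
  have hloss : ∀ k b, Measurable (loss k b) := fun k b => by
    have : Measurable fun X => ∫ x, f k x ∂(T X) :=
      ((hfc k).stronglyMeasurable.integral_kernel).measurable
    fun_prop
  have hass := assouad (fun v => Measure.pi fun _ : Fin n =>
      densityLaw (hypothesisDensity z h κ (s v))) loss hloss
    (δ := ENNReal.ofReal Δ * ENNReal.ofReal (1 / 4)) (R := R) (fun v k => ?_) (fun v => ?_)
  · have h8 : ENNReal.ofReal (Fintype.card ι * Δ / 8) * 2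
        = Fintype.card ι * (ENNReal.ofReal Δ * ENNReal.ofReal (1 / 4)) := by
      rw [← ENNReal.ofReal_mul hΔ, ← ENNReal.ofReal_natCast, ← ENNReal.ofReal_mul (by positivity),
        show (2 : ℝ≥0∞) = ENNReal.ofReal 2 by norm_num, ← ENNReal.ofReal_mul (by positivity)]
      congr 1
      ring
    rw [← h8, mul_comm] at hass
    exact (ENNReal.mul_le_mul_iff_right (by norm_num) (by norm_num)).1 hass
  · have hp := hprob v
    have hq := hprob (Function.update v k (!v k))
    obtain ⟨hai, hage⟩ := affinity_ge (h := h) hd hz hh hκ hκ1 (hs v) k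
    rw [← hsflip] at hai hage
    have hs1 : ∀ v k, |s v k| ≤ 1 := fun v k => by rcases hs v k with h | h <;> simp [h]
    refine two_point_bound (integrable_hypothesisDensity hd hz hκ hκ1 (hs1 _))
      (integrable_hypothesisDensity hd hz hκ hκ1 (hs1 _)) hp.measurable hq.measurable hp.nonneg
      hq.nonneg hp.lintegral_eq_one hq.lintegral_eq_one hai ?_ (hloss _ _) (hloss _ _)
      fun X => ?_
    · -- Bernoulli's inequality
      set D := κ ^ 2 * (h ^ d * ∫ y, unitBump d y)
      set ρ := ∫ x, √(hypothesisDensity z h κ (s v) x *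
        hypothesisDensity z h κ (s (Function.update v k (!v k))) x)
      have hρ0 : 0 ≤ ρ := integral_nonneg fun x => Real.sqrt_nonneg _
      have hB := one_add_mul_le_pow (a := ρ - 1) (by linarith) n
      rw [add_sub_cancel] at hB
      refine le_trans ?_ hB
      have : (n : ℝ) * (-D) ≤ n * (ρ - 1) := by gcongr; linarith
      linarith
    · rw [← ENNReal.ofReal_add (abs_nonneg _) (abs_nonneg _)]
      refine ENNReal.ofReal_le_ofReal ?_
      have hsep := cellMean_sub_ge (k := k) hd hz hh hh1 hκ hκ1
        (c := h / L) (by positivity) (hr k)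
      rw [← hC, ← hΔdef] at hsep
      set t := ∫ x, f k x ∂(T X)
      set θ := cellMean z h κ (h / L) k 1
      set θ' := cellMean z h κ (h / L) k (-1)
      have h1 := le_abs_self (θ - t)
      have h2 := neg_abs_le (θ' - t)
      cases hv : v k
      · simp only [sgn, Bool.not_false, if_true, Bool.false_eq_true, if_false]
        linarith
      · simp only [sgn, Bool.not_true, if_true, Bool.false_eq_true, if_false]
        linarith
  · refine le_trans (lintegral_mono fun X => ?_) (le_iSup₂_of_le _ (hmem (s v) (hs v)) le_rfl)
    have := hlaw v
    refine le_trans (le_of_eq ?_)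
      (sum_abs_sub_le_wassersteinOne hfL (fun k => hfi k _) fun k => hfi k (T X))
    rw [ENNReal.ofReal_sum_of_nonneg fun k _ => abs_nonneg _]
    refine Finset.sum_congr rfl fun k _ => ?_
    simp only [loss]
    rw [← integral_densityLaw_eq_cellMean hd hz hκ hκ1 (s v) (h / L) k]

/-! ### The lattice of cells and the choice of the bandwidth -/

/-- The points of `ℝᵈ` with coordinates in `{1, …, m}`. Positive coordinates keep them apart from
their mirror images. -/
noncomputable def latticePoint {d m : ℕ} (k : Fin d → Fin m) : EuclideanSpace ℝ (Fin d) :=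
  WithLp.toLp 2 fun i => (k i : ℝ) + 1

theorem one_le_norm_signed_latticePoint_sub {d m : ℕ} (hd : 0 < d)
    (i j : (Fin d → Fin m) ⊕ (Fin d → Fin m)) (hij : i ≠ j) :
    1 ≤ ‖signed latticePoint i - signed latticePoint j‖ := by
  have hsame : ∀ k k' : Fin d → Fin m, k ≠ k' → 1 ≤ ‖latticePoint k - latticePoint k'‖ := by
    intro k k' hk
    obtain ⟨a, ha⟩ := Function.ne_iff.1 hk
    refine le_trans ?_ (PiLp.norm_apply_le (latticePoint k - latticePoint k') a)
    have h1 : ((k a : ℕ) : ℤ) ≠ (k' a : ℕ) := by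
      intro h
      exact ha (Fin.ext (by exact_mod_cast h))
    have h2 : (1 : ℤ) ≤ |((k a : ℕ) : ℤ) - (k' a : ℕ)| := Int.one_le_abs (sub_ne_zero.2 h1)
    have h3 : (1 : ℝ) ≤ |((k a : ℕ) : ℝ) - (k' a : ℕ)| := by exact_mod_cast h2
    simpa [latticePoint] using h3
  have hmirror : ∀ k k' : Fin d → Fin m, 1 ≤ ‖latticePoint k + latticePoint k'‖ := by
    intro k k'
    refine le_trans ?_ (PiLp.norm_apply_le (latticePoint k + latticePoint k') ⟨0, hd⟩)
    have h1 : (0 : ℝ) ≤ (k ⟨0, hd⟩ : ℕ) := Nat.cast_nonneg _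
    have h2 : (0 : ℝ) ≤ (k' ⟨0, hd⟩ : ℕ) := Nat.cast_nonneg _
    refine le_trans ?_ (le_abs_self _)
    simp only [latticePoint, PiLp.add_apply]
    linarith
  rcases i with k | k <;> rcases j with k' | k'
  · exact hsame k k' (by simpa using hij)
  · simpa [signed] using hmirror k k'
  · simp only [signed, Sum.elim_inl, Sum.elim_inr]
    rw [← norm_neg, neg_sub, sub_neg_eq_add]
    exact hmirror k' k
  · simp only [signed, Sum.elim_inr]
    rw [neg_sub_neg]
    exact hsame k' k fun h => hij (by rw [h])

theorem norm_latticePoint_le {d m : ℕ} (k : Fin d → Fin m) : ‖latticePoint k‖ ≤ m * √d := by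
  rw [EuclideanSpace.norm_eq]
  refine Real.sqrt_le_iff.2 ⟨by positivity, ?_⟩
  rw [mul_pow, Real.sq_sqrt (Nat.cast_nonneg d)]
  calc ∑ i, ‖latticePoint k i‖ ^ 2 ≤ ∑ _i : Fin d, (m : ℝ) ^ 2 := by
        refine Finset.sum_le_sum fun i _ => pow_le_pow_left₀ (norm_nonneg _) ?_ 2
        simp only [latticePoint]
        rw [Real.norm_of_nonneg (by positivity)]
        exact_mod_cast (k i).2
    _ = _ := by simp [mul_comm]

theorem mainTheorem2 (d : ℕ) (hd : 3 ≤ d) (β : ℝ) (hβ : 0 < β) (K : ℝ) (hK : 1 ≤ K) :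
    ∃ c : ℝ, 0 < c ∧ ∀ n : ℕ, 1 ≤ n →
      ENNReal.ofReal (c * (n : ℝ) ^ (-((β + 1) / (2 * β + (d : ℝ)))))
        ≤ wassersteinMinimaxRisk d n β K := by
  have hd0 : (0 : ℝ) < d := by exact_mod_cast (by omega : 0 < d)
  obtain ⟨ε₀, hε₀, hHolder⟩ := exists_holderENormOn_bumpSum_le
    (unitBump d).contDiff tsupport_unitBump hβ
  obtain ⟨L₀, hL₀⟩ := ((unitBump d).contDiff.continuous_fderiv
    one_ne_zero).bounded_above_of_compact_support ((unitBump d).hasCompactSupport.fderiv ℝ)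
  set L := max L₀ 1
  have hL : 0 < L := lt_max_of_lt_right one_pos
  have hψL : ∀ y, ‖fderiv ℝ (unitBump d) y‖ ≤ L := fun y => (hL₀ y).trans (le_max_left _ _)
  set I := ∫ y, unitBump d y with hI
  have hI0 : 0 ≤ I := integral_nonneg fun y => (unitBump d).nonneg
  -- `ε₀` serves the Hölder norm, the last bound the affinity
  set ε := min (min ε₀ 1) (1 / (4 * (I + 1))) with hε
  have hεpos : 0 < ε := by positivity
  have hεε₀ : ε ≤ ε₀ := (min_le_left _ _).trans (min_le_left _ _)
  have hε1 : ε ≤ 1 := (min_le_left _ _).trans (min_le_right _ _)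
  have hεI : ε ^ 2 * I ≤ 1 / 4 := by
    have h1 : ε * (4 * (I + 1)) ≤ 1 := (le_div_iff₀ (by positivity)).1 (min_le_right _ _)
    have h2 : ε ^ 2 ≤ ε := by nlinarith
    nlinarith
  set C := (2 * (2 * Real.pi) ^ ((d : ℝ) / 2))⁻¹ *
    (2 * Real.exp (-((√d + 1) ^ 2 / 2)) * ∫ y, unitBump d y ^ 2) with hC
  have hCpos : 0 < C := by
    have := integral_unitBump_sq_pos (d := d)
    positivity
  set γ := 2 * β + (d : ℝ) with hγ
  have hγpos : 0 < γ := by positivity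
  refine ⟨ε * C / (8 * L) * 2 ^ (-(β + 1)), by positivity, fun n hn => ?_⟩
  have hn1 : (1 : ℝ) ≤ n := by exact_mod_cast hn
  have hn0 : (0 : ℝ) < n := by linarith
  -- bandwidth `h = 1 / m` with `m` of order `n ^ (1 / (2 β + d))`
  set t := (n : ℝ) ^ (1 / γ) with ht
  have ht1 : 1 ≤ t := Real.one_le_rpow hn1 (by positivity)
  set m := ⌈t⌉₊ with hm
  have hmt : t ≤ m := Nat.le_ceil t
  have hmt2 : (m : ℝ) ≤ 2 * t := by
    have := (Nat.ceil_lt_add_one (zero_le_one.trans ht1)).le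
    linarith
  have hm0 : (0 : ℝ) < m := by linarith
  set h := (m : ℝ)⁻¹ with hh
  have hh0 : 0 < h := by positivity
  have hh1 : h ≤ 1 := inv_le_one_of_one_le₀ (ht1.trans hmt)
  have hκ0 : 0 ≤ ε * h ^ β := by positivity
  have hκ1 : ε * h ^ β ≤ 1 :=
    mul_le_one₀ hε1 (by positivity) (Real.rpow_le_one hh0.le hh1 hβ.le)
  have hz := one_le_norm_signed_latticePoint_sub (d := d) (m := m) (by omega)
  have hnh : n * (h ^ β) ^ 2 * h ^ d ≤ 1 := by
    have h1 : (h ^ β) ^ 2 * h ^ d = (m ^ γ : ℝ)⁻¹ := by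
      rw [← Real.rpow_natCast, ← Real.rpow_natCast, ← Real.rpow_mul hh0.le, ← Real.rpow_add hh0,
        hh, Real.inv_rpow hm0.le, hγ]
      congr 2
      push_cast
      ring
    have h2 : (n : ℝ) ≤ m ^ γ := by
      calc (n : ℝ) = t ^ γ := by
            rw [ht, ← Real.rpow_mul hn0.le, one_div_mul_cancel hγpos.ne', Real.rpow_one]
        _ ≤ m ^ γ := by gcongr
    rw [mul_assoc, h1, ← div_eq_mul_inv]
    exact div_le_one_of_le₀ h2 (by positivity)
  have hrisk := le_wassersteinMinimaxRisk (n := n) (β := β) (K := K) hd hz hh0 hh1 hκ0 hκ1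
    (fun s hs => ?_) ?_ hL hψL (r := √d) fun k => ?_
  · refine le_trans (ENNReal.ofReal_le_ofReal ?_) hrisk
    rw [← hC]
    have hcard : (Fintype.card (Fin d → Fin m) : ℝ) * h ^ d = 1 := by
      rw [Fintype.card_fun, Fintype.card_fin, Fintype.card_fin, hh]
      push_cast
      rw [← mul_pow, mul_inv_cancel₀ hm0.ne', one_pow]
    have hrate : 2 ^ (-(β + 1)) * (n : ℝ) ^ (-((β + 1) / γ)) ≤ h * h ^ β := by
      have h1 : (n : ℝ) ^ (-((β + 1) / γ)) = t ^ (-(β + 1)) := by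
        rw [ht, ← Real.rpow_mul hn0.le]
        congr 1
        ring
      have h2 : h * h ^ β = (m : ℝ) ^ (-(β + 1)) := by
        rw [hh, Real.inv_rpow hm0.le, Real.rpow_neg hm0.le, Real.rpow_add_one hm0.ne', mul_inv,
          mul_comm]
      rw [h1, h2, ← Real.mul_rpow zero_le_two (by positivity)]
      exact Real.rpow_le_rpow_of_nonpos hm0 hmt2 (by linarith)
    calc ε * C / (8 * L) * 2 ^ (-(β + 1)) * (n : ℝ) ^ (-((β + 1) / γ))
        = ε * C / (8 * L) * (2 ^ (-(β + 1)) * (n : ℝ) ^ (-((β + 1) / γ))) := by ring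
      _ ≤ ε * C / (8 * L) * (h * h ^ β) := by gcongr
      _ = ε * C / (8 * L) * (h * h ^ β) * ((Fintype.card (Fin d → Fin m) : ℝ) * h ^ d) := by
          rw [hcard, mul_one]
      _ = _ := by ring
  · have hlog : 2 ≤ Real.log (normalizer (latticePoint : (Fin d → Fin m) → _) h (ε * h ^ β)) := by
      rw [Real.le_log_iff_exp_le (by linarith [eight_le_normalizer (h := h) hd hz hκ0 hκ1])]
      refine le_trans ?_ (eight_le_normalizer (h := h) hd hz hκ0 hκ1)
      have h1 := Real.exp_one_lt_d9
      have h2 : Real.exp 2 = Real.exp 1 ^ 2 := by rw [← Real.exp_nat_mul]; norm_num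
      rw [h2]
      nlinarith [Real.exp_pos 1]
    exact mem_densityModel_of_gaussian hK (contDiff_perturbation _ _ _ s)
      (hHolder ε hεpos hεε₀ hh0 hh1 hz
        (abs_signed_le fun k => by rcases hs k with h | h <;> simp [h]))
      hlog (fun _ => rfl) (isProbDensity_hypothesisDensity hd hz hκ0 hκ1 hs)
  · rw [← hI]
    calc n * ((ε * h ^ β) ^ 2 * (h ^ d * I))
        = n * (h ^ β) ^ 2 * h ^ d * (ε ^ 2 * I) := by ring
      _ ≤ 1 * (1 / 4) := by gcongr
      _ = 1 / 4 := one_mul _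
  · calc h * ‖latticePoint k‖ ≤ h * (m * √d) := by gcongr; exact norm_latticePoint_le k
      _ = √d := by rw [hh, ← mul_assoc, inv_mul_cancel₀ hm0.ne', one_mul]
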